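/- Let $(M,\mathcal S)$, with $\mathcal S\subseteq\mathcal P(M)$, be any (possibly nonstandard) two-sorted structure for the language of second-order arithmetic that is a model of $\mathsf{RCA}_0$: $M$ satisfies $P^-$ (the axioms of discretely ordered commutative semirings in which $x\le y$ iff $\exists z\,(x+z=y)$), and $(M,\mathcal S)$ satisfies $\Delta^0_1$ comprehension and $\Sigma^0_1$ induction. Here $\Sigma^0_n$ and $\Delta^0_n$ are the boldface classes: definability by a $\Sigma_n$ formula (by both a $\Sigma_n$ and a $\Pi_n$ formula) with number parameters from $M$ and set parameters from $\mathcal S$. "Infinite" means unbounded in $M$. Consider the following statements about $(M,\mathcal S)$. (i) $\mathsf{COH}$: for every sequence $\langle R_i : i\in M\rangle$ of sets with $\{\langle x,i\rangle : x\in R_i\}\in\mathcal S$ there is an infinite $C\in\mathcal S$ such that for every $i\in M$ either $C\setminus R_i$ or $C\cap R_i$ is bounded. (ii) The $\Sigma^0_2$ separation principle: if $A_0,A_1\subseteq M$ are disjoint $\Sigma^0_2$ sets, there is a $\Delta^0_2$ set $D$ with $A_0\subseteq D\subseteq M\setminus A_1$. (iii) Every infinite $\Delta^0_2$ binary tree $T$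 has an infinite $\Delta^0_2$ path. Here finite binary strings are coded by nonzero elements of $M$ (prepend the digit $1$ and read in base two), a binary tree is a set of strings closed under initial segments, and a path of $T$ is a binary tree $P\subseteq T$ that is totally ordered by end-extension. If $(M,\mathcal S)$ also satisfies bounding for $\Sigma^0_2$ formulas, $\mathrm B\Sigma^0_2$, then (i), (ii) and (iii) are equivalent. In other words, (i), (ii) and (iii) are equivalent over $\mathsf{RCA}_0+\mathrm B\Sigma^0_2$. Moreover, the implication (i)$\Rightarrow$(ii) holds in every model of $\mathsf{RCA}_0$, without $\mathrm B\Sigma^0_2$. -/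

import Mathlib

universe u

namespace SecondOrderArith

/-- The base theory `P⁻`: discretely ordered commutative semirings in which `x ≤ y` holds exactly
when `y = x + z` for some `z` (so every element is nonnegative). No induction is included. -/
class PMinus (M : Type u) extends
    CommSemiring M, LinearOrder M, IsStrictOrderedRing M, CanonicallyOrderedAdd M where
  one_le_of_pos : ∀ x : M, 0 < x → 1 ≤ x

/-- Number terms in `k` variables, with constants for the elements of `M`. -/
inductive NumTerm (M : Type u) (k : ℕ) : Type u
  | var (i : Fin k) : NumTerm M k
  | const (a : M) : NumTerm M k
  | zero : NumTerm M k
  | one : NumTerm M k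
  | add (s t : NumTerm M k) : NumTerm M k
  | mul (s t : NumTerm M k) : NumTerm M k

/-- Bounded-quantifier (`Σ⁰₀`) formulas of second-order arithmetic in `k` free number variables,
with number parameters from `M` and set parameters from `S` (finitely many of each).
`ballLT t φ` is `∀ x < t, φ`, where `x` is variable `0` of `φ` and the old variables are shifted
up by one; in particular `x` does not occur in `t`. The other connectives and the bounded
existential quantifier are definable from these. -/
inductive BddFormula {M : Type u} (S : Set (Set M)) : ℕ → Type u
  | eq {k : ℕ} (s t : NumTerm M k) : BddFormula S k
  | lt {k : ℕ} (s t : NumTerm M k) : BddFormula S k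
  | mem {k : ℕ} (t : NumTerm M k) (A : Set M) (hA : A ∈ S) : BddFormula S k
  | not {k : ℕ} (φ : BddFormula S k) : BddFormula S k
  | and {k : ℕ} (φ ψ : BddFormula S k) : BddFormula S k
  | ballLT {k : ℕ} (t : NumTerm M k) (φ : BddFormula S (k + 1)) : BddFormula S k

section

variable {M : Type u} [PMinus M]

/-- The value of a term. -/
def NumTerm.val {k : ℕ} (v : Fin k → M) : NumTerm M k → M
  | .var i => v i
  | .const a => a
  | .zero => 0
  | .one => 1
  | .add s t => s.val v + t.val v
  | .mul s t => s.val v * t.val v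

/-- Truth of a bounded formula under an assignment to its free variables. -/
def BddFormula.Realize {S : Set (Set M)} : {k : ℕ} → BddFormula S k → (Fin k → M) → Prop
  | _, .eq s t, v => s.val v = t.val v
  | _, .lt s t, v => s.val v < t.val v
  | _, .mem t A _, v => t.val v ∈ A
  | _, .not φ, v => ¬ φ.Realize v
  | _, .and φ ψ, v => φ.Realize v ∧ ψ.Realize v
  | _, .ballLT t φ, v => ∀ x : M, x < t.val v → φ.Realize (Fin.cons x v)

/-- The `k`-ary relation `R` on `M` is definable in `(M, S)` by a `Σ⁰ₙ` formula
`∃ x₁ ∀ x₂ ∃ x₃ … θ` (`n` alternating quantifiers, `θ` bounded) with parameters from `M` and `S`.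
In the successor step `Q` is a `Πₙ` relation, that is, its negation is `Σₙ`. -/
def SigmaDef (S : Set (Set M)) : ℕ → {k : ℕ} → ((Fin k → M) → Prop) → Prop
  | 0, k, R => ∃ φ : BddFormula S k, ∀ v, R v ↔ φ.Realize v
  | n + 1, k, R => ∃ Q : (Fin (k + 1) → M) → Prop,
      SigmaDef S n (fun w => ¬ Q w) ∧ ∀ v, R v ↔ ∃ x : M, Q (Fin.cons x v)

/-- `A` is a (boldface) `Σ⁰ₙ` set of the structure `(M, S)`. -/
def IsSigma (S : Set (Set M)) (n : ℕ) (A : Set M) : Prop :=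
  SigmaDef S n (fun v : Fin 1 → M => v 0 ∈ A)

/-- `A` is a (boldface) `Δ⁰ₙ` set of `(M, S)`: both `A` and its complement are `Σ⁰ₙ`. -/
def IsDelta (S : Set (Set M)) (n : ℕ) (A : Set M) : Prop :=
  IsSigma S n A ∧ IsSigma S n Aᶜ

/-- `Δ⁰₁` comprehension. -/
def DeltaOneCA (S : Set (Set M)) : Prop :=
  ∀ A : Set M, IsDelta S 1 A → A ∈ S

/-- Induction for `Σ⁰ₙ` sets. -/
def ISigma (S : Set (Set M)) (n : ℕ) : Prop :=
  ∀ A : Set M, IsSigma S n A → 0 ∈ A → (∀ x, x ∈ A → x + 1 ∈ A) → ∀ x, x ∈ A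

/-- Bounding for `Σ⁰ₙ` formulas. -/
def BSigma (S : Set (Set M)) (n : ℕ) : Prop :=
  ∀ φ : M → M → Prop, SigmaDef S n (fun v : Fin 2 → M => φ (v 0) (v 1)) →
    ∀ x₀ : M, (∀ x, x < x₀ → ∃ y, φ x y) → ∃ y₀, ∀ x, x < x₀ → ∃ y, y < y₀ ∧ φ x y

/-- `(M, S)` is a model of `RCA₀`: `P⁻` (by the type class on `M`), `Δ⁰₁` comprehension
and `Σ⁰₁` induction. -/
structure ModelsRCA0 (S : Set (Set M)) : Prop where
  comprehension : DeltaOneCA S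
  induction : ISigma S 1

/-- Some element of `M` is a strict upper bound of `A`. -/
def Bounded (A : Set M) : Prop := ∃ b : M, ∀ a, a ∈ A → a < b

/-- Infinite means unbounded in `M`. -/
def Unbounded (A : Set M) : Prop := ¬ Bounded A

/-- The quadratic pairing function `⟨x, i⟩ = (x + i)² + x`. -/
def pair (x i : M) : M := (x + i) ^ 2 + x

/-- The sequence `R` of sets, indexed by `M`, is uniformly `Δ⁰₁`, i.e. coded by a member of `S`. -/
def UniformlyDeltaOne (S : Set (Set M)) (R : M → Set M) : Prop :=
  {p : M | ∃ x i : M, p = pair x i ∧ x ∈ R i} ∈ S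

/-- `C` is cohesive for the sequence `R`: for every `i`, almost all elements of `C` are in `R i`
or almost all elements of `C` are outside `R i`. -/
def IsCohesive (R : M → Set M) (C : Set M) : Prop :=
  ∀ i : M, Bounded (C \ R i) ∨ Bounded (C ∩ R i)

/-- The principle `COH`. -/
def COH (S : Set (Set M)) : Prop :=
  ∀ R : M → Set M, UniformlyDeltaOne S R → ∃ C, C ∈ S ∧ Unbounded C ∧ IsCohesive R C

/-- The `Σ⁰₂` separation principle. -/
def SigmaTwoSeparation (S : Set (Set M)) : Prop :=
  ∀ A₀ A₁ : Set M, IsSigma S 2 A₀ → IsSigma S 2 A₁ → Disjoint A₀ A₁ →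
    ∃ D, IsDelta S 2 D ∧ A₀ ⊆ D ∧ D ⊆ A₁ᶜ

/-- `p` is a power of two (in the sense of `M`): every divisor of `p` other than `1` is even. -/
def IsPowTwo (p : M) : Prop := ∀ d : M, d ∣ p → d = 1 ∨ 2 ∣ d

/-- Binary strings of `M` are coded by the nonzero elements of `M`: prepend the digit `1` to the
string and read it in base two. `IsPrefix σ τ` says that `σ` and `τ` code strings and
that the string `τ` extends (or equals) `σ`: `τ` is `σ` followed by the `k` digits of some
`r < 2 ^ k`. -/
def IsPrefix (σ τ : M) : Prop :=
  σ ≠ 0 ∧ ∃ p r : M, IsPowTwo p ∧ r < p ∧ τ = σ * p + r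

/-- A binary tree: a set of (codes of) binary strings closed under initial segments. -/
def IsBinaryTree (T : Set M) : Prop :=
  (∀ σ, σ ∈ T → σ ≠ 0) ∧ ∀ σ τ, IsPrefix σ τ → τ ∈ T → σ ∈ T

/-- A path: a binary tree totally ordered by extension. -/
def IsPath (P : Set M) : Prop :=
  IsBinaryTree P ∧ ∀ σ τ, σ ∈ P → τ ∈ P → IsPrefix σ τ ∨ IsPrefix τ σ

/-- Every infinite `Δ⁰₂` binary tree has an infinite `Δ⁰₂` path. -/
def DeltaTwoTreesHavePaths (S : Set (Set M)) : Prop :=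
  ∀ T : Set M, IsDelta S 2 T → IsBinaryTree T → Unbounded T →
    ∃ P, IsDelta S 2 P ∧ IsPath P ∧ Unbounded P ∧ P ⊆ T

end

end SecondOrderArith

/-!
The proof runs through the implications `COH` → separation → paths → `COH`. Only the last two use
`BΣ⁰₂`.

The common tool is `exists_approximation`: two disjoint `Σ⁰₂` sets have a `Δ⁰₁` approximation that
converges to yes on the first set and to no on the second one.

* `COH.sigmaTwoSeparation`: a cohesive set for the sequence of the sets `{t | the approximation at
  stage t says yes to i}` decides, for each `i`, what the approximation says almost always on the
  cohesive set. This is a `Δ⁰₂` separating set.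
* `SigmaTwoSeparation.deltaTwoTreesHavePaths`: this is the argument by which `Σ⁰₁` separation
  gives weak Kőnig's lemma, one level up. The set `A₀` consists of the `σ` whose child `σ0` has no
  extension in the tree of a length for which `σ1` still has one, and `A₁` is defined
  symmetrically. The path that follows a separating set never leaves the tree: for a fixed length,
  induction along the path shows that its initial segments extend to a string of that length in
  the tree. By `BΣ⁰₂`, the inductions involved, which are `Δ⁰₂`, are available
  (`delta_two_least`).
* `DeltaTwoTreesHavePaths.coh`: the tree of the strings that describe how some large number lies
  with respect to the first sets of the sequence has a `Δ⁰₂` path. The path is approximated by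
  `exists_approximation`, and `BΣ⁰₂` makes the approximation settle simultaneously on initial
  segments. At each `s` one searches for a stage and a number in agreement below `s`; the numbers
  found form a cohesive set (`cohesive_of_approximation`). The digits of strings are indexed by
  all of `M` here, so exponentiation is needed (`exists_exp`). It is obtained from `IΣ⁰₁` with
  finite sets coded by divisibility (`exists_code`).

Definability is handled by type classes: `Sg S n P` and `Pg S n P` say that `P` is `Σ⁰ₙ` or `Π⁰ₙ`,
and instances mirror the ways of forming formulas.
-/

namespace SecondOrderArith

section

variable {M : Type u} [PMinus M] {S : Set (Set M)} {k n : ℕ}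

/-! ### Definability by terms and by arithmetical formulas -/

/-- `f` is the value of a number term. This and the definability predicates below are type
classes, so that instance search derives the definability of a relation from the way it is
written. -/
class TermFn (f : (Fin k → M) → M) : Prop where
  out : ∃ t : NumTerm M k, ∀ v, f v = t.val v

instance TermFn.var (i : Fin k) : TermFn (fun v : Fin k → M => v i) := ⟨.var i, fun _ => rfl⟩
instance TermFn.const (a : M) : TermFn (fun _ : Fin k → M => a) := ⟨.const a, fun _ => rfl⟩

instance TermFn.add (f g : (Fin k → M) → M) [hf : TermFn f] [hg : TermFn g] :
    TermFn (fun v => f v + g v) := by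
  obtain ⟨s, hs⟩ := hf.out
  obtain ⟨t, ht⟩ := hg.out
  exact ⟨.add s t, fun v => by rw [hs, ht]; rfl⟩

instance TermFn.mul (f g : (Fin k → M) → M) [hf : TermFn f] [hg : TermFn g] :
    TermFn (fun v => f v * g v) := by
  obtain ⟨s, hs⟩ := hf.out
  obtain ⟨t, ht⟩ := hg.out
  exact ⟨.mul s t, fun v => by rw [hs, ht]; rfl⟩

instance TermFn.pair (f g : (Fin k → M) → M) [TermFn f] [TermFn g] :
    TermFn (fun v => SecondOrderArith.pair (f v) (g v)) := by
  simp only [SecondOrderArith.pair, sq]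
  infer_instance

/-- Substitution of terms into a term. -/
theorem TermFn.comp {m : ℕ} {f : (Fin k → M) → M} (hf : TermFn f) {g : Fin k → (Fin m → M) → M}
    (hg : ∀ i, TermFn (g i)) : TermFn (fun w => f (fun i => g i w)) := by
  obtain ⟨t, ht⟩ := hf.out
  obtain rfl : f = fun v => t.val v := funext ht
  clear ht hf
  induction t with
  | var i => exact hg i
  | const a => exact TermFn.const a
  | zero => exact ⟨.zero, fun _ => rfl⟩
  | one => exact ⟨.one, fun _ => rfl⟩
  | add s t hs ht => exact TermFn.add (hf := hs) (hg := ht)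
  | mul s t hs ht => exact TermFn.mul (hf := hs) (hg := ht)

/-- The relation `P` is `Σ⁰ₙ`; `n = 0` is definability by a bounded formula. -/
class Sg (S : Set (Set M)) (n : ℕ) (P : (Fin k → M) → Prop) : Prop where
  out : SigmaDef S n P

/-- The relation `P` is `Π⁰ₙ`, that is, its negation is `Σ⁰ₙ`. -/
class Pg (S : Set (Set M)) (n : ℕ) (P : (Fin k → M) → Prop) : Prop where
  out : Sg S n (fun v => ¬ P v)

/-- `BΣ⁰ⱼ` holds for all `1 ≤ j ≤ n`: what the closure of `Σ⁰ₙ` under bounded quantifiers rests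
on. -/
class HasB (S : Set (Set M)) (n : ℕ) : Prop where
  out : ∀ j, j < n → BSigma S (j + 1)

theorem Sg.congr {n : ℕ} {P Q : (Fin k → M) → Prop} (hP : Sg S n P) (h : ∀ v, Q v ↔ P v) :
    Sg S n Q := by
  rwa [show Q = P from funext fun v => propext (h v)]

theorem Pg.congr {n : ℕ} {P Q : (Fin k → M) → Prop} (hP : Pg S n P) (h : ∀ v, Q v ↔ P v) :
    Pg S n Q := by
  rwa [show Q = P from funext fun v => propext (h v)]

theorem Sg.zero_iff {P : (Fin k → M) → Prop} :
    Sg S 0 P ↔ ∃ φ : BddFormula S k, ∀ v, P v ↔ φ.Realize v := ⟨fun h => h.out, fun h => ⟨h⟩⟩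

theorem Sg.succ_iff {n : ℕ} {P : (Fin k → M) → Prop} :
    Sg S (n + 1) P ↔ ∃ Q : (Fin (k + 1) → M) → Prop, Pg S n Q ∧
      ∀ v, P v ↔ ∃ x, Q (Fin.cons x v) :=
  ⟨fun h => let ⟨Q, hQ, h⟩ := h.out; ⟨Q, ⟨⟨hQ⟩⟩, h⟩, fun ⟨Q, hQ, h⟩ => ⟨Q, hQ.out.out, h⟩⟩

theorem Sg.not_zero {P : (Fin k → M) → Prop} (h : Sg S 0 P) : Sg S 0 (fun v => ¬ P v) := by
  obtain ⟨φ, hφ⟩ := Sg.zero_iff.1 h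
  exact Sg.zero_iff.2 ⟨.not φ, fun v => not_congr (hφ v)⟩

instance Sg.not {n : ℕ} {P : (Fin k → M) → Prop} [h : Pg S n P] : Sg S n (fun v => ¬ P v) := h.out

instance Pg.not {n : ℕ} {P : (Fin k → M) → Prop} [h : Sg S n P] : Pg S n (fun v => ¬ P v) :=
  ⟨h.congr fun _ => not_not⟩

instance Pg.zero {P : (Fin k → M) → Prop} [h : Sg S 0 P] : Pg S 0 P := ⟨h.not_zero⟩

theorem Sg.of_pg_zero {P : (Fin k → M) → Prop} (h : Pg S 0 P) : Sg S 0 P :=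
  h.out.not_zero.congr fun _ => not_not.symm

/-- Substitution of terms for the variables of a `Σ⁰ₙ` relation. -/
theorem Sg.comp {n m : ℕ} {P : (Fin k → M) → Prop} (hP : Sg S n P) {g : Fin k → (Fin m → M) → M}
    (hg : ∀ i, TermFn (g i)) : Sg S n (fun w => P (fun i => g i w)) := by
  induction n generalizing k m with
  | zero =>
    obtain ⟨φ, hφ⟩ := Sg.zero_iff.1 hP
    obtain rfl : P = φ.Realize := funext fun v => propext (hφ v)
    clear hφ hP
    induction φ generalizing m with
    | eq s t =>
      obtain ⟨s', hs⟩ := (TermFn.comp ⟨s, fun _ => rfl⟩ hg).out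
      obtain ⟨t', ht⟩ := (TermFn.comp ⟨t, fun _ => rfl⟩ hg).out
      exact Sg.zero_iff.2 ⟨.eq s' t', fun v => by simp only [BddFormula.Realize, hs, ht]⟩
    | lt s t =>
      obtain ⟨s', hs⟩ := (TermFn.comp ⟨s, fun _ => rfl⟩ hg).out
      obtain ⟨t', ht⟩ := (TermFn.comp ⟨t, fun _ => rfl⟩ hg).out
      exact Sg.zero_iff.2 ⟨.lt s' t', fun v => by simp only [BddFormula.Realize, hs, ht]⟩
    | mem t A hA =>
      obtain ⟨t', ht⟩ := (TermFn.comp ⟨t, fun _ => rfl⟩ hg).out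
      exact Sg.zero_iff.2 ⟨.mem t' A hA, fun v => by simp only [BddFormula.Realize, ht]⟩
    | not φ h => exact (h hg).not_zero
    | and φ ψ h₁ h₂ =>
      obtain ⟨φ', h₁⟩ := Sg.zero_iff.1 (h₁ hg)
      obtain ⟨ψ', h₂⟩ := Sg.zero_iff.1 (h₂ hg)
      exact Sg.zero_iff.2 ⟨.and φ' ψ', fun v => by simp only [BddFormula.Realize, h₁, h₂]⟩
    | @ballLT j t φ h =>
      obtain ⟨t', ht⟩ := (TermFn.comp ⟨t, fun _ => rfl⟩ hg).out
      obtain ⟨φ', h⟩ := Sg.zero_iff.1 (h (m := m + 1)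
        (g := Fin.cons (fun w => w 0) (fun i w => g i (Fin.tail w)))
        (fun i => by
          refine Fin.cases (TermFn.var 0) (fun i => ?_) i
          exact (hg i).comp (fun j => TermFn.var j.succ)))
      refine Sg.zero_iff.2 ⟨.ballLT t' φ', fun v => ?_⟩
      simp only [BddFormula.Realize, ht]
      refine forall₂_congr fun x _ => (iff_of_eq ?_).trans (h _)
      congr 1
      ext i
      refine Fin.cases rfl (fun i => ?_) i
      simp
  | succ n ih =>
    obtain ⟨Q, hQ, h⟩ := Sg.succ_iff.1 hP
    refine Sg.succ_iff.2 ⟨_, ⟨ih (m := m + 1) hQ.out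
        (g := Fin.cons (fun w => w 0) (fun i w => g i (Fin.tail w)))
        (fun i => by
          refine Fin.cases (TermFn.var 0) (fun i => ?_) i
          exact (hg i).comp (fun j => TermFn.var j.succ))⟩, fun v => ?_⟩
    rw [h]
    refine exists_congr fun x => iff_of_eq ?_
    congr 1
    ext i
    refine Fin.cases rfl (fun i => ?_) i
    simp

theorem Pg.comp {n m : ℕ} {P : (Fin k → M) → Prop} (hP : Pg S n P) {g : Fin k → (Fin m → M) → M}
    (hg : ∀ i, TermFn (g i)) : Pg S n (fun w => P (fun i => g i w)) := ⟨hP.out.comp hg⟩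

/-! ### Closure properties of the arithmetical classes -/

/-- `Σ⁰ₙ₊₁` relations, with the quantified variable kept apart from the others. -/
theorem Sg.succ_iff₁ {P : (Fin k → M) → Prop} :
    Sg S (n + 1) P ↔ ∃ Q : M → (Fin k → M) → Prop,
      Pg S n (fun w : Fin (k + 1) → M => Q (w 0) (fun i => w i.succ)) ∧
      ∀ v, P v ↔ ∃ x, Q x v := by
  rw [Sg.succ_iff]
  constructor
  · rintro ⟨Q, hQ, h⟩
    refine ⟨fun x v => Q (Fin.cons x v), hQ.congr fun w => ?_, h⟩
    exact iff_of_eq (congrArg Q (Fin.cons_self_tail w))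
  · rintro ⟨Q, hQ, h⟩
    exact ⟨_, hQ, h⟩

/-- `Sg.succ_iff₁` for a relation which has a distinguished variable of its own. -/
theorem Sg.succ_iff₂ {P : M → (Fin k → M) → Prop}
    (hP : Sg S (n + 1) (fun w : Fin (k + 1) → M => P (w 0) (fun i => w i.succ))) :
    ∃ Q : M → M → (Fin k → M) → Prop,
      Pg S n (fun w : Fin (k + 2) → M => Q (w 0) (w 1) (fun i => w i.succ.succ)) ∧
      ∀ y v, P y v ↔ ∃ x, Q x y v := by
  obtain ⟨Q, hQ, h⟩ := Sg.succ_iff₁.1 hP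
  refine ⟨fun x y v => Q x (Fin.cons y v), hQ.congr fun w => ?_, fun y v => h (Fin.cons y v)⟩
  exact iff_of_eq (congrArg (Q (w 0)) (Fin.cons_self_tail fun i : Fin (k + 1) => w i.succ))

theorem Sg.comp₁ {m : ℕ} {Q : M → (Fin k → M) → Prop}
    (hQ : Sg S n (fun w : Fin (k + 1) → M => Q (w 0) (fun i => w i.succ)))
    (a : (Fin m → M) → M) (g : Fin k → (Fin m → M) → M) [ha : TermFn a] [hg : ∀ i, TermFn (g i)] :
    Sg S n (fun w => Q (a w) (fun i => g i w)) :=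
  hQ.comp (g := Fin.cons a g) (fun i => Fin.cases ha hg i)

theorem Pg.comp₁ {m : ℕ} {Q : M → (Fin k → M) → Prop}
    (hQ : Pg S n (fun w : Fin (k + 1) → M => Q (w 0) (fun i => w i.succ)))
    (a : (Fin m → M) → M) (g : Fin k → (Fin m → M) → M) [ha : TermFn a] [hg : ∀ i, TermFn (g i)] :
    Pg S n (fun w => Q (a w) (fun i => g i w)) :=
  ⟨hQ.out.comp₁ (Q := fun x v => ¬ Q x v) a g⟩

theorem Pg.comp₂ {m : ℕ} {Q : M → M → (Fin k → M) → Prop}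
    (hQ : Pg S n (fun w : Fin (k + 2) → M => Q (w 0) (w 1) (fun i => w i.succ.succ)))
    (a b : (Fin m → M) → M) (g : Fin k → (Fin m → M) → M) [ha : TermFn a] [hb : TermFn b]
    [hg : ∀ i, TermFn (g i)] :
    Pg S n (fun w => Q (a w) (b w) (fun i => g i w)) :=
  hQ.comp (g := Fin.cons a (Fin.cons b g)) (fun i => Fin.cases ha (Fin.cases hb hg) i)

theorem Sg.of_pg {P : (Fin k → M) → Prop} (hP : Pg S n P) : Sg S (n + 1) P :=
  Sg.succ_iff₁.2 ⟨fun _ v => P v, hP.comp fun i => TermFn.var i.succ, fun v => by simp⟩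

theorem Pg.of_sg {P : (Fin k → M) → Prop} (hP : Sg S n P) : Pg S (n + 1) P :=
  ⟨Sg.of_pg Pg.not⟩

theorem Sg.succ {P : (Fin k → M) → Prop} (hP : Sg S n P) : Sg S (n + 1) P := by
  induction n generalizing k with
  | zero => exact Sg.of_pg inferInstance
  | succ n ih =>
    obtain ⟨Q, hQ, h⟩ := Sg.succ_iff₁.1 hP
    exact Sg.succ_iff₁.2 ⟨Q, ⟨ih hQ.out⟩, h⟩

/-- The `Σ⁰ₙ` relations are closed under `∧`, `∨` and bounded quantifiers. The matrix of a
quantifier has its bound variable as variable `0`. -/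
structure Closed (S : Set (Set M)) (n : ℕ) : Prop where
  and : ∀ {k : ℕ} {P Q : (Fin k → M) → Prop}, Sg S n P → Sg S n Q → Sg S n (fun v => P v ∧ Q v)
  or : ∀ {k : ℕ} {P Q : (Fin k → M) → Prop}, Sg S n P → Sg S n Q → Sg S n (fun v => P v ∨ Q v)
  ball : ∀ {k : ℕ} {t : (Fin k → M) → M} {P : M → (Fin k → M) → Prop}, TermFn t →
    Sg S n (fun w : Fin (k + 1) → M => P (w 0) (fun i => w i.succ)) →
    Sg S n (fun v => ∀ x, x < t v → P x v)
  bex : ∀ {k : ℕ} {t : (Fin k → M) → M} {P : M → (Fin k → M) → Prop}, TermFn t →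
    Sg S n (fun w : Fin (k + 1) → M => P (w 0) (fun i => w i.succ)) →
    Sg S n (fun v => ∃ x, x < t v ∧ P x v)

theorem closed_zero : Closed S 0 := by
  have and : ∀ {k : ℕ} {P Q : (Fin k → M) → Prop}, Sg S 0 P → Sg S 0 Q →
      Sg S 0 (fun v => P v ∧ Q v) := by
    intro k P Q hP hQ
    obtain ⟨φ, hφ⟩ := Sg.zero_iff.1 hP
    obtain ⟨ψ, hψ⟩ := Sg.zero_iff.1 hQ
    exact Sg.zero_iff.2 ⟨.and φ ψ, fun v => and_congr (hφ v) (hψ v)⟩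
  have ball : ∀ {k : ℕ} {t : (Fin k → M) → M} {P : M → (Fin k → M) → Prop}, TermFn t →
      Sg S 0 (fun w : Fin (k + 1) → M => P (w 0) (fun i => w i.succ)) →
      Sg S 0 (fun v => ∀ x, x < t v → P x v) := by
    intro k t P ht hP
    obtain ⟨t', ht⟩ := ht.out
    obtain ⟨φ, hφ⟩ := Sg.zero_iff.1 hP
    refine Sg.zero_iff.2 ⟨.ballLT t' φ, fun v => ?_⟩
    simp only [BddFormula.Realize, ht]
    exact forall₂_congr fun x _ => hφ (Fin.cons x v)
  refine ⟨and, fun hP hQ => (and hP.not_zero hQ.not_zero).not_zero.congr fun v => by tauto, ball,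
    fun ht hP => (ball (P := fun x v => ¬ _) ht hP.not_zero).not_zero.congr fun v => ?_⟩
  push Not
  rfl

/-- The same closure properties for `Π⁰ₙ`. -/
theorem Closed.dual (h : Closed S n) :
    (∀ {k : ℕ} {P Q : (Fin k → M) → Prop}, Pg S n P → Pg S n Q → Pg S n (fun v => P v ∧ Q v)) ∧
    (∀ {k : ℕ} {P Q : (Fin k → M) → Prop}, Pg S n P → Pg S n Q → Pg S n (fun v => P v ∨ Q v)) ∧
    (∀ {k : ℕ} {t : (Fin k → M) → M} {P : M → (Fin k → M) → Prop}, TermFn t →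
      Pg S n (fun w : Fin (k + 1) → M => P (w 0) (fun i => w i.succ)) →
      Pg S n (fun v => ∀ x, x < t v → P x v)) ∧
    (∀ {k : ℕ} {t : (Fin k → M) → M} {P : M → (Fin k → M) → Prop}, TermFn t →
      Pg S n (fun w : Fin (k + 1) → M => P (w 0) (fun i => w i.succ)) →
      Pg S n (fun v => ∃ x, x < t v ∧ P x v)) := by
  refine ⟨fun hP hQ => ⟨(h.or hP.out hQ.out).congr fun v => by tauto⟩,
    fun hP hQ => ⟨(h.and hP.out hQ.out).congr fun v => by tauto⟩,
    fun ht hP => ⟨(h.bex (P := fun x v => ¬ _) ht hP.out).congr fun v => ?_⟩,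
    fun ht hP => ⟨(h.ball (P := fun x v => ¬ _) ht hP.out).congr fun v => ?_⟩⟩
  · push Not
    rfl
  · push Not
    rfl

theorem exists_bound_two (x y : M) : ∃ z, x < z ∧ y < z :=
  ⟨max x y + 1, (le_max_left x y).trans_lt (lt_add_one _),
    (le_max_right x y).trans_lt (lt_add_one _)⟩

/-- Bounding moves a bounded universal quantifier past the leading existential one. For
conjunctions, the two witnesses are put below a common bound. -/
theorem closed_succ (h : Closed S n) (hB : BSigma S (n + 1)) : Closed S (n + 1) := by
  obtain ⟨and, or, ball, bex⟩ := h.dual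
  refine ⟨?_, ?_, ?_, ?_⟩
  · intro k P P' hP hP'
    obtain ⟨Q, hQ, h⟩ := Sg.succ_iff₁.1 hP
    obtain ⟨Q', hQ', h'⟩ := Sg.succ_iff₁.1 hP'
    refine Sg.succ_iff₁.2 ⟨fun z v => (∃ x, x < z ∧ Q x v) ∧ (∃ x, x < z ∧ Q' x v),
      and (bex inferInstance (hQ.comp₁ _ _)) (bex inferInstance (hQ'.comp₁ _ _)), fun v => ?_⟩
    rw [h, h']
    constructor
    · rintro ⟨⟨x, hx⟩, ⟨y, hy⟩⟩
      obtain ⟨z, hxz, hyz⟩ := exists_bound_two x y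
      exact ⟨z, ⟨x, hxz, hx⟩, ⟨y, hyz, hy⟩⟩
    · rintro ⟨z, ⟨x, -, hx⟩, ⟨y, -, hy⟩⟩
      exact ⟨⟨x, hx⟩, ⟨y, hy⟩⟩
  · intro k P P' hP hP'
    obtain ⟨Q, hQ, h⟩ := Sg.succ_iff₁.1 hP
    obtain ⟨Q', hQ', h'⟩ := Sg.succ_iff₁.1 hP'
    refine Sg.succ_iff₁.2 ⟨fun x v => Q x v ∨ Q' x v, or hQ hQ', fun v => ?_⟩
    rw [h, h', exists_or]
  · intro k t P ht hP
    obtain ⟨Q, hQ, h⟩ := Sg.succ_iff₂ hP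
    have ht' : TermFn (fun w : Fin (k + 1) → M => t (fun i => w i.succ)) :=
      ht.comp fun i => TermFn.var i.succ
    refine Sg.succ_iff₁.2 ⟨fun z v => ∀ y, y < t v → ∃ x, x < z ∧ Q x y v,
      ball ht' (bex inferInstance (hQ.comp₂ _ _ _)), fun v => ?_⟩
    simp only [h]
    constructor
    · exact hB (fun y x => Q x y v) (Sg.of_pg
        (hQ.comp₂ (fun w : Fin 2 → M => w 1) (fun w => w 0) (fun i _ => v i))).out _
    · rintro ⟨z, hz⟩ y hy
      obtain ⟨x, -, hx⟩ := hz y hy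
      exact ⟨x, hx⟩
  · intro k t P ht hP
    obtain ⟨Q, hQ, h⟩ := Sg.succ_iff₂ hP
    have ht' : TermFn (fun w : Fin (k + 1) → M => t (fun i => w i.succ)) :=
      ht.comp fun i => TermFn.var i.succ
    refine Sg.succ_iff₁.2 ⟨fun z v => ∃ y, y < t v ∧ Q z y v,
      bex ht' (hQ.comp₂ _ _ _), fun v => ?_⟩
    simp only [h]
    constructor
    · rintro ⟨y, hy, x, hx⟩
      exact ⟨x, y, hy, hx⟩
    · rintro ⟨x, y, hy, hx⟩
      exact ⟨y, hy, x, hx⟩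

theorem closed [hB : HasB S n] : Closed S n := by
  have key : ∀ m, m ≤ n → Closed S m := by
    intro m
    induction m with
    | zero => exact fun _ => closed_zero
    | succ m ih => exact fun hm => closed_succ (ih (by omega)) (hB.out m (by omega))
  exact key n le_rfl

instance HasB.zero : HasB S 0 := ⟨fun j hj => absurd hj (Nat.not_lt_zero j)⟩

variable {P Q : (Fin k → M) → Prop} {t s : (Fin k → M) → M} {R : M → (Fin k → M) → Prop}

instance Sg.eq [ht : TermFn t] [hs : TermFn s] : Sg S 0 (fun v => t v = s v) := by
  obtain ⟨t', ht⟩ := ht.out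
  obtain ⟨s', hs⟩ := hs.out
  exact Sg.zero_iff.2 ⟨.eq t' s', fun v => by rw [ht, hs]; rfl⟩

instance Sg.lt [ht : TermFn t] [hs : TermFn s] : Sg S 0 (fun v => t v < s v) := by
  obtain ⟨t', ht⟩ := ht.out
  obtain ⟨s', hs⟩ := hs.out
  exact Sg.zero_iff.2 ⟨.lt t' s', fun v => by rw [ht, hs]; rfl⟩

instance Sg.le [TermFn t] [TermFn s] : Sg S 0 (fun v => t v ≤ s v) := by
  simp only [← not_lt]
  infer_instance

/-- `A` is a `Σ⁰ₙ` set, as an instance argument. -/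
class SgSet (S : Set (Set M)) (n : ℕ) (A : Set M) : Prop where
  out : IsSigma S n A

instance Sg.mem [ht : TermFn t] {A : Set M} [h : SgSet S n A] : Sg S n (fun v => t v ∈ A) :=
  Sg.comp ⟨h.out⟩ (fun _ => ht)

/-- `A` is a `Π⁰ₙ` set, as an instance argument. -/
class PgSet (S : Set (Set M)) (n : ℕ) (A : Set M) : Prop where
  out : IsSigma S n Aᶜ

instance Pg.mem [ht : TermFn t] {A : Set M} [h : PgSet S n A] : Pg S n (fun v => t v ∈ A) :=
  ⟨Sg.comp (P := fun v : Fin 1 → M => ¬ v 0 ∈ A) ⟨h.out⟩ (fun _ => ht)⟩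

instance Sg.and [HasB S n] [hP : Sg S n P] [hQ : Sg S n Q] : Sg S n (fun v => P v ∧ Q v) :=
  closed.and hP hQ

instance Sg.or [HasB S n] [hP : Sg S n P] [hQ : Sg S n Q] : Sg S n (fun v => P v ∨ Q v) :=
  closed.or hP hQ

instance Pg.and [HasB S n] [hP : Pg S n P] [hQ : Pg S n Q] : Pg S n (fun v => P v ∧ Q v) :=
  closed.dual.1 hP hQ

instance Pg.or [HasB S n] [hP : Pg S n P] [hQ : Pg S n Q] : Pg S n (fun v => P v ∨ Q v) :=
  closed.dual.2.1 hP hQ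

instance Sg.imp [HasB S n] [hP : Pg S n P] [hQ : Sg S n Q] : Sg S n (fun v => P v → Q v) := by
  simp only [imp_iff_not_or]
  infer_instance

instance Pg.imp [HasB S n] [hP : Sg S n P] [hQ : Pg S n Q] : Pg S n (fun v => P v → Q v) := by
  simp only [imp_iff_not_or]
  infer_instance

instance Sg.iff [HasB S n] [Sg S n P] [Sg S n Q] [Pg S n P] [Pg S n Q] :
    Sg S n (fun v => P v ↔ Q v) := by
  simp only [iff_iff_implies_and_implies]
  infer_instance

instance Pg.iff [HasB S n] [Sg S n P] [Sg S n Q] [Pg S n P] [Pg S n Q] :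
    Pg S n (fun v => P v ↔ Q v) := by
  simp only [iff_iff_implies_and_implies]
  infer_instance

instance Sg.ball [HasB S n] [ht : TermFn t]
    [h : Sg S n (fun w : Fin (k + 1) → M => R (w 0) (fun i => w i.succ))] :
    Sg S n (fun v => ∀ x, x < t v → R x v) := closed.ball ht h

instance Sg.bex [HasB S n] [ht : TermFn t]
    [h : Sg S n (fun w : Fin (k + 1) → M => R (w 0) (fun i => w i.succ))] :
    Sg S n (fun v => ∃ x, x < t v ∧ R x v) := closed.bex ht h

instance Pg.bex [HasB S n] [ht : TermFn t]
    [h : Pg S n (fun w : Fin (k + 1) → M => R (w 0) (fun i => w i.succ))] :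
    Pg S n (fun v => ∃ x, x < t v ∧ R x v) := closed.dual.2.2.2 ht h

theorem lt_add_one_iff_le {x y : M} : x < y + 1 ↔ x ≤ y := by
  constructor
  · intro h
    by_contra! hlt
    obtain ⟨z, rfl⟩ := exists_add_of_le hlt.le
    have hz : 0 < z := by
      rcases eq_or_ne z 0 with rfl | hz
      · simp at hlt
      · exact pos_iff_ne_zero.2 hz
    exact absurd h (not_lt.2 (add_le_add_right (PMinus.one_le_of_pos z hz) y))
  · exact fun h => h.trans_lt (lt_add_one _)

instance Sg.ball_le [HasB S n] [ht : TermFn t]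
    [h : Sg S n (fun w : Fin (k + 1) → M => R (w 0) (fun i => w i.succ))] :
    Sg S n (fun v => ∀ x, x ≤ t v → R x v) := by
  simp only [← lt_add_one_iff_le]
  infer_instance

instance Sg.bex_le [HasB S n] [ht : TermFn t]
    [h : Sg S n (fun w : Fin (k + 1) → M => R (w 0) (fun i => w i.succ))] :
    Sg S n (fun v => ∃ x, x ≤ t v ∧ R x v) := by
  simp only [← lt_add_one_iff_le]
  infer_instance

instance Pg.bex_le [HasB S n] [ht : TermFn t]
    [h : Pg S n (fun w : Fin (k + 1) → M => R (w 0) (fun i => w i.succ))] :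
    Pg S n (fun v => ∃ x, x ≤ t v ∧ R x v) := by
  simp only [← lt_add_one_iff_le]
  infer_instance

/-- Two existential quantifiers are contracted to one by a common bound on their witnesses. -/
instance Sg.ex [hn : NeZero n] [hB : HasB S n]
    [h : Sg S n (fun w : Fin (k + 1) → M => R (w 0) (fun i => w i.succ))] :
    Sg S n (fun v => ∃ x, R x v) := by
  obtain ⟨n, rfl⟩ := Nat.exists_eq_succ_of_ne_zero hn.out
  have : HasB S n := ⟨fun j hj => hB.out j (by omega)⟩
  obtain ⟨Q, hQ, h⟩ := Sg.succ_iff₂ h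
  refine Sg.succ_iff₁.2 ⟨fun z v => ∃ x, x < z ∧ ∃ y, y < z ∧ Q y x v, ?_, fun v => ?_⟩
  · have : Pg S n (fun w : Fin (k + 1 + 1 + 1) → M =>
        Q (w 0) (w 1) (fun i => w i.succ.succ.succ)) :=
      hQ.comp₂ (fun w : Fin (k + 1 + 1 + 1) → M => w 0) (fun w => w 1)
        (fun i w => w i.succ.succ.succ)
    exact Pg.bex (h := Pg.bex (h := this))
  · simp only [h]
    constructor
    · rintro ⟨x, y, hxy⟩
      obtain ⟨z, hx, hy⟩ := exists_bound_two x y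
      exact ⟨z, x, hx, y, hy, hxy⟩
    · rintro ⟨z, x, -, y, -, hxy⟩
      exact ⟨x, y, hxy⟩

instance Pg.all [NeZero n] [HasB S n]
    [h : Pg S n (fun w : Fin (k + 1) → M => R (w 0) (fun i => w i.succ))] :
    Pg S n (fun v => ∀ x, R x v) := by
  constructor
  have := h.out
  simp only [not_forall]
  infer_instance

/-- The inclusions between successive levels. They have low priority, so that the structure of a
formula is used up first. -/
instance (priority := low) Sg.lift_pg [h : Pg S n P] : Sg S (n + 1) P := .of_pg h
instance (priority := low) Sg.lift_sg [h : Sg S n P] : Sg S (n + 1) P := .succ h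
instance (priority := low) Pg.lift_sg [h : Sg S n P] : Pg S (n + 1) P := .of_sg h

instance Sg.dvd [ht : TermFn t] [hs : TermFn s] : Sg S 0 (fun v => t v ∣ s v) := by
  have key : ∀ a b : M, a ∣ b ↔ ∃ c, c ≤ b ∧ b = a * c := fun a b => by
    constructor
    · rintro ⟨c, rfl⟩
      rcases eq_or_ne a 0 with rfl | ha
      · exact ⟨0, by simp⟩
      · exact ⟨c, le_mul_of_one_le_left zero_le (PMinus.one_le_of_pos a (pos_iff_ne_zero.2 ha)),
          rfl⟩
    · rintro ⟨c, -, rfl⟩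
      exact dvd_mul_right a c
  have : TermFn (fun w : Fin (k + 1) → M => t (fun i => w i.succ)) :=
    ht.comp fun i => TermFn.var i.succ
  have : TermFn (fun w : Fin (k + 1) → M => s (fun i => w i.succ)) :=
    hs.comp fun i => TermFn.var i.succ
  simp only [key]
  infer_instance

/-! ### Induction, bounding, comprehension -/

theorem sigma_one_induction [hR : Fact (ModelsRCA0 S)] {P : M → Prop}
    [hP : Sg S 1 (fun v : Fin 1 → M => P (v 0))] (h0 : P 0) (hs : ∀ x, P x → P (x + 1)) :
    ∀ x, P x :=
  hR.out.induction {x | P x} hP.out h0 hs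

/-- `BΣ⁰₁` follows from `IΣ⁰₁`, by induction on the length of the initial segment that is bounded.
The witness and the variable of the matrix are bounded together, so that the induction hypothesis
is `Σ⁰₁`. The closure instances above level `0` are not yet available here. -/
theorem bSigma_one (hR : ModelsRCA0 S) : BSigma S 1 := by
  intro φ hφ x₀ hx₀
  obtain ⟨Q, hQ, h⟩ := Sg.succ_iff₁.1 (⟨hφ⟩ : Sg S 1 _)
  have hQ := Sg.of_pg_zero hQ
  obtain ⟨θ, hθ⟩ : ∃ θ : M → M → M → Prop, ∀ z v, Q z v ↔ θ z (v 0) (v 1) :=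
    ⟨fun z x y => Q z ![x, y], fun z v => by
      refine iff_of_eq (congrArg (Q z) ?_)
      ext i
      fin_cases i <;> rfl⟩
  simp only [hθ] at hQ h
  have inst {m : ℕ} (a b c : (Fin m → M) → M) [ha : TermFn a] [hb : TermFn b] [hc : TermFn c] :
      Sg S 0 (fun w => θ (a w) (b w) (c w)) :=
    hQ.comp (g := ![a, b, c]) (fun i => by fin_cases i <;> assumption)
  have h : ∀ x y, φ x y ↔ ∃ z, θ z x y := fun x y => h ![x, y]
  have := Fact.mk hR
  have key : ∀ x, ∃ b, x ≤ x₀ → ∀ x', x' < x → ∃ y, y < b ∧ ∃ z, z < b ∧ θ z x' y := by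
    have : Sg S 1 (fun v : Fin 1 → M =>
        ∃ b, v 0 ≤ x₀ → ∀ x', x' < v 0 → ∃ y, y < b ∧ ∃ z, z < b ∧ θ z x' y) :=
      Sg.succ_iff₁.2 ⟨fun b v => v 0 ≤ x₀ → ∀ x', x' < v 0 → ∃ y, y < b ∧ ∃ z, z < b ∧ θ z x' y,
        inferInstance, fun v => Iff.rfl⟩
    refine sigma_one_induction (S := S) ⟨0, fun _ x' hx' => absurd hx' not_lt_zero⟩ ?_
    rintro x ⟨b, hb⟩
    by_cases hx : x < x₀
    · obtain ⟨y, hy⟩ := hx₀ x hx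
      obtain ⟨z, hz⟩ := (h x y).1 hy
      obtain ⟨c, hyc, hzc⟩ := exists_bound_two y z
      refine ⟨max b c, fun _ x' hx' => ?_⟩
      rcases (lt_add_one_iff_le.1 hx').eq_or_lt with rfl | hlt
      · exact ⟨y, lt_max_of_lt_right hyc, z, lt_max_of_lt_right hzc, hz⟩
      · obtain ⟨y, hy, z, hz, hθ⟩ := hb hx.le x' hlt
        exact ⟨y, lt_max_of_lt_left hy, z, lt_max_of_lt_left hz, hθ⟩
    · exact ⟨0, fun hx' => absurd ((lt_add_one x).trans_le hx') hx⟩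
  obtain ⟨b, hb⟩ := key x₀
  refine ⟨b, fun x hx => ?_⟩
  obtain ⟨y, hy, z, -, hθ⟩ := hb le_rfl x hx
  exact ⟨y, hy, (h x y).2 ⟨z, hθ⟩⟩

instance HasB.one [hR : Fact (ModelsRCA0 S)] : HasB S 1 :=
  ⟨fun j hj => by
    obtain rfl : j = 0 := by omega
    exact bSigma_one hR.out⟩

instance HasB.two [hR : Fact (ModelsRCA0 S)] [hB : Fact (BSigma S 2)] : HasB S 2 :=
  ⟨fun j hj => by
    obtain rfl | rfl : j = 0 ∨ j = 1 := by omega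
    · exact bSigma_one hR.out
    · exact hB.out⟩

theorem bounding_one [hR : Fact (ModelsRCA0 S)] {P : M → M → Prop}
    [hP : Sg S 1 (fun v : Fin 2 → M => P (v 0) (v 1))] {a : M}
    (h : ∀ x, x < a → ∃ y, P x y) : ∃ b, ∀ x, x < a → ∃ y, y < b ∧ P x y :=
  bSigma_one hR.out P hP.out a h

theorem bounding_two [hB : Fact (BSigma S 2)] {P : M → M → Prop}
    [hP : Sg S 2 (fun v : Fin 2 → M => P (v 0) (v 1))] {a : M}
    (h : ∀ x, x < a → ∃ y, P x y) : ∃ b, ∀ x, x < a → ∃ y, y < b ∧ P x y :=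
  hB.out P hP.out a h

/-- The least number principle for `Π⁰₁`: if it fails for `P`, then `Σ⁰₁` induction shows that no
number satisfies `P`. -/
theorem pi_one_least [Fact (ModelsRCA0 S)] {P : M → Prop}
    [hP : Pg S 1 (fun v : Fin 1 → M => P (v 0))] (h : ∃ x, P x) :
    ∃ x, P x ∧ ∀ y, y < x → ¬ P y := by
  by_contra! hcon
  have h1 : Sg S 1 (fun v : Fin 1 → M => ¬ P (v 0)) := inferInstance
  have h2 : Sg S 1 (fun v : Fin 2 → M => ¬ P (v 0)) := h1.comp (g := ![fun v => v 0])
    (fun i => by fin_cases i; exact TermFn.var 0)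
  have key : ∀ x y, y < x → ¬ P y := by
    refine sigma_one_induction (S := S) (fun y hy => absurd hy not_lt_zero) fun x hx y hy hPy => ?_
    obtain ⟨z, hz, hPz⟩ := hcon y hPy
    exact hx z (hz.trans_le (lt_add_one_iff_le.1 hy)) hPz
  obtain ⟨x, hx⟩ := h
  exact key (x + 1) x (lt_add_one x) hx

/-- The least number principle for `Δ⁰₂`. By `BΣ⁰₂` the witnesses that decide `P` on an initial
segment have a common bound, so that `P` is `Π⁰₁` there. -/
theorem delta_two_least [Fact (ModelsRCA0 S)] [Fact (BSigma S 2)] {P : M → Prop}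
    [hP : Sg S 2 (fun v : Fin 1 → M => P (v 0))] [hP' : Pg S 2 (fun v : Fin 1 → M => P (v 0))]
    (h : ∃ x, P x) : ∃ x, P x ∧ ∀ y, y < x → ¬ P y := by
  obtain ⟨Q, hQ, hPQ⟩ := Sg.succ_iff₁.1 hP
  obtain ⟨Q', hQ', hPQ'⟩ := Sg.succ_iff₁.1 hP'.out
  have hPQ : ∀ x, P x ↔ ∃ a, Q a (fun _ => x) := fun x => hPQ (fun _ => x)
  have hPQ' : ∀ x, ¬ P x ↔ ∃ a, Q' a (fun _ => x) := fun x => hPQ' (fun _ => x)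
  have inst {m : ℕ} (a b : (Fin m → M) → M) [TermFn a] [TermFn b] :
      Pg S 1 (fun w => Q (a w) (fun _ => b w)) := hQ.comp₁ a (fun _ => b)
  have inst' {m : ℕ} (a b : (Fin m → M) → M) [TermFn a] [TermFn b] :
      Pg S 1 (fun w => Q' (a w) (fun _ => b w)) := hQ'.comp₁ a (fun _ => b)
  obtain ⟨x₀, hx₀⟩ := h
  obtain ⟨b, hb⟩ := bounding_two (S := S) (a := x₀ + 1)
    (P := fun x a => Q a (fun _ => x) ∨ Q' a (fun _ => x)) (fun x _ => by
      by_cases hx : P x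
      · exact ((hPQ x).1 hx).imp fun _ => Or.inl
      · exact ((hPQ' x).1 hx).imp fun _ => Or.inr)
  have hle : ∀ x, x ≤ x₀ → P x → ∃ a, a < b ∧ Q a (fun _ => x) := by
    intro x hx hPx
    obtain ⟨a, ha, h | h⟩ := hb x (lt_add_one_iff_le.2 hx)
    · exact ⟨a, ha, h⟩
    · exact absurd hPx ((hPQ' x).2 ⟨a, h⟩)
  obtain ⟨x, ⟨hx, a, -, hQx⟩, hmin⟩ := pi_one_least (S := S)
    (P := fun x => x ≤ x₀ ∧ ∃ a, a < b ∧ Q a (fun _ => x)) ⟨x₀, le_rfl, hle x₀ le_rfl hx₀⟩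
  refine ⟨x, (hPQ x).2 ⟨a, hQx⟩, fun y hy hPy => hmin y hy ?_⟩
  exact ⟨hy.le.trans hx, hle y (hy.le.trans hx) hPy⟩

theorem delta_one_mem [hR : Fact (ModelsRCA0 S)] {P : M → Prop}
    (h : Sg S 1 (fun v : Fin 1 → M => P (v 0)))
    (h' : Pg S 1 (fun v : Fin 1 → M => P (v 0))) : {x | P x} ∈ S :=
  hR.out.comprehension _ ⟨h.out, h'.out.out⟩

theorem SgSet.of_mem {A : Set M} (hA : A ∈ S) : SgSet S 0 A :=
  ⟨⟨.mem (.var 0) A hA, fun _ => Iff.rfl⟩⟩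

/-! ### Powers of two -/

/-- Course-of-values induction for bounded formulas. Here and below, `S` is explicit where it does
not occur in the conclusion. -/
theorem strong_induction (S : Set (Set M)) [Fact (ModelsRCA0 S)] {P : M → Prop}
    [hP : Sg S 0 (fun v : Fin 1 → M => P (v 0))] (h : ∀ x, (∀ y, y < x → P y) → P x) :
    ∀ x, P x := by
  by_contra! hcon
  obtain ⟨x, hx, hmin⟩ := pi_one_least (S := S) hcon
  exact hx (h x fun y hy => not_not.1 (hmin y hy))

theorem add_one_le_of_lt {x y : M} (h : x < y) : x + 1 ≤ y :=
  lt_add_one_iff_le.1 (by simpa using h)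

theorem exists_eq_mul_add (S : Set (Set M)) [Fact (ModelsRCA0 S)] {m : M} (hm : 0 < m) (x : M) :
    ∃ q r, r < m ∧ x = q * m + r := by
  have key : ∀ x, ∃ q, q ≤ x ∧ ∃ r, r < m ∧ x = q * m + r := by
    refine sigma_one_induction (S := S) ⟨0, le_rfl, 0, hm, by simp⟩ ?_
    rintro x ⟨q, hq, r, hr, rfl⟩
    rcases (add_one_le_of_lt hr).eq_or_lt with h | h
    · refine ⟨q + 1, add_le_add_left hq 1, 0, hm, ?_⟩
      rw [add_assoc, h]
      ring
    · exact ⟨q, hq.trans (lt_add_one _).le, r + 1, h, add_assoc _ _ _⟩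
  obtain ⟨q, -, r, hr, h⟩ := key x
  exact ⟨q, r, hr, h⟩

theorem lt_two_iff {r : M} : r < 2 ↔ r = 0 ∨ r = 1 := by
  rw [show (2 : M) = 1 + 1 by norm_num, lt_add_one_iff_le, le_iff_lt_or_eq,
    show r < 1 ↔ r < 0 + 1 by simp, lt_add_one_iff_le, nonpos_iff_eq_zero]

theorem even_or_odd (S : Set (Set M)) [Fact (ModelsRCA0 S)] (x : M) :
    ∃ y, x = 2 * y ∨ x = 2 * y + 1 := by
  obtain ⟨y, r, hr, rfl⟩ := exists_eq_mul_add S (zero_lt_two (α := M)) x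
  rcases lt_two_iff.1 hr with rfl | rfl
  · exact ⟨y, .inl (by ring)⟩
  · exact ⟨y, .inr (by ring)⟩

theorem two_mul_ne_two_mul_add_one (a b : M) : (2 : M) * a ≠ 2 * b + 1 := by
  intro h
  rcases le_or_gt a b with hab | hab
  · exact absurd h ((mul_le_mul_of_nonneg_left hab zero_le_two).trans_lt (lt_add_one _)).ne
  · have := mul_le_mul_of_nonneg_left (add_one_le_of_lt hab) (zero_le_two (α := M))
    rw [h, mul_add, mul_one, show (2 : M) = 1 + 1 by norm_num, ← add_assoc] at this
    exact absurd this (not_le.2 (lt_add_one _))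

theorem not_isPowTwo_zero : ¬ IsPowTwo (0 : M) := by
  intro h
  rcases h 3 (dvd_zero 3) with h | ⟨c, hc⟩
  · norm_num at h
  · exact two_mul_ne_two_mul_add_one c 1 (by rw [← hc]; norm_num)

theorem IsPowTwo.pos {p : M} (hp : IsPowTwo p) : 0 < p :=
  pos_iff_ne_zero.2 fun h => not_isPowTwo_zero (h ▸ hp)

theorem le_of_dvd_of_pos {a b : M} (h : a ∣ b) (hb : 0 < b) : a ≤ b := by
  obtain ⟨c, rfl⟩ := h
  refine le_mul_of_one_le_right zero_le (PMinus.one_le_of_pos c (pos_iff_ne_zero.2 ?_))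
  rintro rfl
  simp at hb

theorem isPowTwo_one : IsPowTwo (1 : M) := by
  intro d hd
  have hle := le_of_dvd_of_pos hd zero_lt_one
  have hd0 : d ≠ 0 := by
    rintro rfl
    exact one_ne_zero (zero_dvd_iff.1 hd)
  exact .inl (hle.antisymm (PMinus.one_le_of_pos d (pos_iff_ne_zero.2 hd0)))

theorem IsPowTwo.two_mul (S : Set (Set M)) [Fact (ModelsRCA0 S)] {p : M} (hp : IsPowTwo p) :
    IsPowTwo (2 * p) := by
  rintro d ⟨e, he⟩
  obtain ⟨d', rfl | rfl⟩ := even_or_odd S d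
  · exact .inr (dvd_mul_right 2 d')
  · obtain ⟨e', rfl | rfl⟩ := even_or_odd S e
    · refine hp _ ⟨e', ?_⟩
      refine mul_left_cancel₀ (two_ne_zero (α := M)) ?_
      rw [he]
      ring
    · exact absurd (he.trans (by ring)) (two_mul_ne_two_mul_add_one p (2 * d' * e' + d' + e'))

theorem IsPowTwo.eq_one_or (S : Set (Set M)) [Fact (ModelsRCA0 S)] {p : M} (hp : IsPowTwo p) :
    p = 1 ∨ ∃ q, IsPowTwo q ∧ p = 2 * q ∧ q < p := by
  rcases hp p dvd_rfl with h | ⟨q, rfl⟩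
  · exact .inl h
  · refine .inr ⟨q, fun d hd => hp d (hd.mul_left 2), rfl, ?_⟩
    exact lt_mul_of_one_lt_left (pos_iff_ne_zero.2 fun h => hp.pos.ne' (by simp [h])) one_lt_two

instance Sg.isPowTwo {t : (Fin k → M) → M} [ht : TermFn t] : Sg S 0 (fun v => IsPowTwo (t v)) := by
  have : TermFn (fun w : Fin (k + 1) → M => t (fun i => w i.succ)) :=
    ht.comp fun i => TermFn.var i.succ
  have key : ∀ p : M, IsPowTwo p ↔ p ≠ 0 ∧ ∀ d, d ≤ p → d ∣ p → d = 1 ∨ 2 ∣ d := fun p =>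
    ⟨fun h => ⟨h.pos.ne', fun d _ hd => h d hd⟩,
      fun h d hd => h.2 d (le_of_dvd_of_pos hd (pos_iff_ne_zero.2 h.1)) hd⟩
  simp only [key, ne_eq]
  infer_instance

theorem IsPowTwo.induction (S : Set (Set M)) [Fact (ModelsRCA0 S)] {P : M → Prop}
    [hP : Sg S 0 (fun v : Fin 1 → M => P (v 0))] (h1 : P 1)
    (h2 : ∀ p, IsPowTwo p → P p → P (2 * p)) : ∀ p, IsPowTwo p → P p := by
  refine strong_induction S fun p ih hp => ?_
  rcases hp.eq_one_or S with rfl | ⟨q, hq, rfl, hlt⟩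
  · exact h1
  · exact h2 q hq (ih q hlt hq)

theorem IsPowTwo.mul (S : Set (Set M)) [Fact (ModelsRCA0 S)] {p q : M} (hp : IsPowTwo p)
    (hq : IsPowTwo q) : IsPowTwo (p * q) := by
  refine IsPowTwo.induction S (P := fun p => IsPowTwo (p * q)) (by simpa) (fun p _ h => ?_) p hp
  rw [mul_assoc]
  exact h.two_mul S

theorem IsPowTwo.exists_eq_mul (S : Set (Set M)) [Fact (ModelsRCA0 S)] {p q : M} (hp : IsPowTwo p)
    (hq : IsPowTwo q) (hpq : p ≤ q) : ∃ m, IsPowTwo m ∧ q = p * m := by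
  have key : ∀ q : M, IsPowTwo q → ∀ p, p ≤ q → IsPowTwo p →
      ∃ m, m ≤ q ∧ IsPowTwo m ∧ q = p * m := by
    refine strong_induction S fun q ih hq p hpq hp => ?_
    rcases hp.eq_one_or S with rfl | ⟨p', hp', rfl, hlt⟩
    · exact ⟨q, le_rfl, hq, (one_mul q).symm⟩
    · rcases hq.eq_one_or S with rfl | ⟨q', hq', rfl, hlt'⟩
      · exact absurd (hlt.trans_le hpq) (not_lt.2 (PMinus.one_le_of_pos _ hp'.pos))
      · obtain ⟨m, hm, hm2, rfl⟩ := ih q' hlt' hq' p' (le_of_mul_le_mul_left hpq zero_lt_two) hp'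
        exact ⟨m, hm.trans hlt'.le, hm2, (mul_assoc _ _ _).symm⟩
  obtain ⟨m, -, h⟩ := key q hq p hpq hp
  exact ⟨m, h⟩

theorem two_mul_add_one_lt {a b : M} (h : a < b) : (2 : M) * a + 1 < 2 * b := by
  have := mul_le_mul_of_nonneg_left (add_one_le_of_lt h) (zero_le_two (α := M))
  refine lt_of_lt_of_le ?_ this
  rw [mul_add, mul_one]
  exact add_lt_add_right one_lt_two _

/-! ### Pairing and normal forms -/

theorem le_sq_self (x : M) : x ≤ x ^ 2 := by
  rcases eq_or_ne x 0 with rfl | h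
  · simp
  · exact le_self_pow₀ (PMinus.one_le_of_pos x (pos_iff_ne_zero.2 h)) two_ne_zero

theorem left_le_pair (x i : M) : x ≤ pair x i := le_add_self

theorem right_le_pair (x i : M) : i ≤ pair x i :=
  (le_add_self : i ≤ x + i).trans ((le_sq_self _).trans le_self_add)

theorem pair_mono {x x' i i' : M} (hx : x ≤ x') (hi : i ≤ i') : pair x i ≤ pair x' i' :=
  add_le_add (pow_le_pow_left₀ zero_le (add_le_add hx hi) 2) hx

theorem pair_lt_of_add_lt {x i y j : M} (h : x + i < y + j) : pair x i < pair y j := by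
  have h1 : pair x i < (x + i + 1) ^ 2 := by
    have : (x + i + 1) ^ 2 = pair x i + (x + i + i) + 1 := by unfold pair; ring
    rw [this, lt_add_one_iff_le]
    exact le_self_add
  exact h1.trans_le ((pow_le_pow_left₀ zero_le (add_one_le_of_lt h) 2).trans le_self_add)

theorem pair_inj {x i y j : M} (h : pair x i = pair y j) : x = y ∧ i = j := by
  have hs : x + i = y + j := by
    rcases lt_trichotomy (x + i) (y + j) with hlt | heq | hlt
    · exact absurd h (pair_lt_of_add_lt hlt).ne
    · exact heq
    · exact absurd h (pair_lt_of_add_lt hlt).ne'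
  have hx : x = y := by
    unfold pair at h
    rw [hs] at h
    exact add_left_cancel h
  subst hx
  exact ⟨rfl, add_left_cancel hs⟩

/-- A `Δ⁰₁` relation is coded by a member of `S`, and can hence be used in bounded formulas. -/
theorem exists_pair_mem_iff [Fact (ModelsRCA0 S)] {θ : M → M → Prop}
    [hθ : Sg S 1 (fun v : Fin 2 → M => θ (v 0) (v 1))]
    [hθ' : Pg S 1 (fun v : Fin 2 → M => θ (v 0) (v 1))] :
    ∃ U, U ∈ S ∧ ∀ a b, pair a b ∈ U ↔ θ a b := by
  have inst {m : ℕ} (a b : (Fin m → M) → M) [ha : TermFn a] [hb : TermFn b] :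
      Sg S 1 (fun w => θ (a w) (b w)) :=
    hθ.comp (g := ![a, b]) (fun i => by fin_cases i <;> assumption)
  have inst' {m : ℕ} (a b : (Fin m → M) → M) [ha : TermFn a] [hb : TermFn b] :
      Pg S 1 (fun w => θ (a w) (b w)) :=
    hθ'.comp (g := ![a, b]) (fun i => by fin_cases i <;> assumption)
  refine ⟨{u | ∃ a, a ≤ u ∧ ∃ b, b ≤ u ∧ u = pair a b ∧ θ a b},
    delta_one_mem inferInstance inferInstance, fun a b => ⟨?_, fun h => ?_⟩⟩
  · rintro ⟨a', -, b', -, h, hθ⟩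
    obtain ⟨rfl, rfl⟩ := pair_inj h
    exact hθ
  · exact ⟨a, left_le_pair a b, b, right_le_pair a b, rfl, h⟩

theorem exists_triple_mem_iff [Fact (ModelsRCA0 S)] {θ : M → M → M → Prop}
    [hθ : Sg S 0 (fun v : Fin 3 → M => θ (v 0) (v 1) (v 2))] :
    ∃ U, U ∈ S ∧ ∀ a b c, pair a (pair b c) ∈ U ↔ θ a b c := by
  have inst {m : ℕ} (a b c : (Fin m → M) → M) [ha : TermFn a] [hb : TermFn b] [hc : TermFn c] :
      Sg S 0 (fun w => θ (a w) (b w) (c w)) :=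
    hθ.comp (g := ![a, b, c]) (fun i => by fin_cases i <;> assumption)
  obtain ⟨U, hU, h⟩ := exists_pair_mem_iff (S := S)
    (θ := fun a d => ∃ b, b ≤ d ∧ ∃ c, c ≤ d ∧ d = pair b c ∧ θ a b c)
  refine ⟨U, hU, fun a b c => (h _ _).trans ⟨?_, fun hθ => ?_⟩⟩
  · rintro ⟨b', -, c', -, h, hθ⟩
    obtain ⟨rfl, rfl⟩ := pair_inj h
    exact hθ
  · exact ⟨b, left_le_pair b c, c, right_le_pair b c, rfl, hθ⟩

/-- Normal form of `Σ⁰₂` sets: the matrix is a member of `S`. -/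
theorem exists_sigma_two_matrix [Fact (ModelsRCA0 S)] (A : Set M) [hA : SgSet S 2 A] :
    ∃ U, U ∈ S ∧ ∀ i, i ∈ A ↔ ∃ a, ∀ b, pair i (pair a b) ∈ U := by
  obtain ⟨Q, hQ, hAQ⟩ := Sg.succ_iff₁.1 (⟨hA.out⟩ : Sg S 2 _)
  obtain ⟨Q', hQ', hQQ'⟩ := Sg.succ_iff₂ (P := fun x v => ¬ Q x v) hQ.out
  have hθ : Sg S 0 (fun v : Fin 3 → M => ¬ Q' (v 2) (v 1) (fun _ => v 0)) :=
    (hQ'.comp₂ (fun v : Fin 3 → M => v 2) (fun v => v 1) (fun _ v => v 0)).out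
  obtain ⟨U, hU, h⟩ := exists_triple_mem_iff (S := S) (θ := fun i a b => ¬ Q' b a (fun _ => i))
  refine ⟨U, hU, fun i => (hAQ (fun _ => i)).trans (exists_congr fun a => ?_)⟩
  simp only [h]
  rw [← not_exists, ← hQQ', not_not]

/-! ### Approximating disjoint `Σ⁰₂` sets -/

/-- Disjoint `Σ⁰₂` sets have a common `Δ⁰₁` approximation: eventually yes on `A₀` and eventually
no on `A₁`. At stage `t`, `i` is put in if the least witness for `i ∈ A₀` not refuted below `t`
comes no later than the one for `i ∈ A₁`. Only `BΣ⁰₁` is used. -/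
theorem exists_approximation [Fact (ModelsRCA0 S)] {A₀ A₁ : Set M} [SgSet S 2 A₀] [SgSet S 2 A₁]
    (hdisj : Disjoint A₀ A₁) : ∃ E, E ∈ S ∧
      (∀ i, i ∈ A₀ → ∃ m, ∀ t, m ≤ t → pair t i ∈ E) ∧
      (∀ i, i ∈ A₁ → ∃ m, ∀ t, m ≤ t → pair t i ∉ E) := by
  obtain ⟨U₀, hU₀, h₀⟩ := exists_sigma_two_matrix (S := S) A₀
  obtain ⟨U₁, hU₁, h₁⟩ := exists_sigma_two_matrix (S := S) A₁
  have := SgSet.of_mem hU₀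
  have := SgSet.of_mem hU₁
  obtain ⟨E, hE, h⟩ := exists_pair_mem_iff (S := S)
    (θ := fun t i => ∃ a, a < t ∧ (∀ b, b < t → pair i (pair a b) ∈ U₀) ∧
      ∀ a', a' < a → ∃ b, b < t ∧ pair i (pair a' b) ∉ U₁)
  refine ⟨E, hE, fun i hi => ?_, fun i hi => ?_⟩
  · have hi' : i ∉ A₁ := fun h => hdisj.le_bot ⟨hi, h⟩
    rw [h₁] at hi'
    push Not at hi'
    obtain ⟨a, ha⟩ := (h₀ i).1 hi
    obtain ⟨B, hB⟩ := bounding_one (S := S) (P := fun a' b => pair i (pair a' b) ∉ U₁)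
      (a := a) fun x _ => hi' x
    obtain ⟨m, ham, hBm⟩ := exists_bound_two a B
    refine ⟨m, fun t ht => (h t i).2 ⟨a, ham.trans_le ht, fun b _ => ha b, fun a' ha' => ?_⟩⟩
    obtain ⟨b, hb, hb'⟩ := hB a' ha'
    exact ⟨b, hb.trans (hBm.trans_le ht), hb'⟩
  · have hi' : i ∉ A₀ := fun h => hdisj.le_bot ⟨h, hi⟩
    rw [h₀] at hi'
    push Not at hi'
    obtain ⟨a₁, ha₁⟩ := (h₁ i).1 hi
    obtain ⟨B, hB⟩ := bounding_one (S := S) (P := fun a' b => pair i (pair a' b) ∉ U₀)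
      (a := a₁ + 1) fun x _ => hi' x
    refine ⟨B, fun t ht hcon => ?_⟩
    obtain ⟨a, -, ha, ha'⟩ := (h t i).1 hcon
    rcases lt_or_ge a₁ a with hlt | hle
    · obtain ⟨b, -, hb⟩ := ha' a₁ hlt
      exact hb (ha₁ b)
    · obtain ⟨b, hb, hb'⟩ := hB a (lt_add_one_iff_le.2 hle)
      exact hb' (ha b (hb.trans_le ht))

/-! ### Cohesive sets give separating sets -/

theorem exists_mem_ge {C : Set M} (hC : Unbounded C) (b : M) : ∃ a, a ∈ C ∧ b ≤ a := by
  by_contra! h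
  exact hC ⟨b, h⟩

/-- The set of the `i` such that almost all of a cohesive set for the approximation says yes to
`i` separates; cohesiveness makes it `Δ⁰₂`. -/
theorem COH.sigmaTwoSeparation [Fact (ModelsRCA0 S)] (h : COH S) : SigmaTwoSeparation S := by
  intro A₀ A₁ hA₀ hA₁ hdisj
  have := SgSet.mk hA₀
  have := SgSet.mk hA₁
  obtain ⟨E, hE, h₀, h₁⟩ := exists_approximation (S := S) hdisj
  have := SgSet.of_mem hE
  obtain ⟨C, hC, hCu, hcoh⟩ := h (fun i => {t | pair t i ∈ E}) (by
    have : {p : M | ∃ x i, p = pair x i ∧ x ∈ {t | pair t i ∈ E}} =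
        {p | p ∈ E ∧ ∃ x, x ≤ p ∧ ∃ i, i ≤ p ∧ p = pair x i} := by
      ext p
      constructor
      · rintro ⟨x, i, rfl, h⟩
        exact ⟨h, x, left_le_pair x i, i, right_le_pair x i, rfl⟩
      · rintro ⟨h, x, -, i, -, rfl⟩
        exact ⟨x, i, rfl, h⟩
    unfold UniformlyDeltaOne
    rw [this]
    exact delta_one_mem inferInstance inferInstance)
  have := SgSet.of_mem hC
  have hexcl : ∀ i, (∃ m, ∀ t, m ≤ t → t ∈ C → pair t i ∈ E) →
      (∃ m, ∀ t, m ≤ t → t ∈ C → pair t i ∉ E) → False := by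
    rintro i ⟨m, hm⟩ ⟨m', hm'⟩
    obtain ⟨a, haC, ha⟩ := exists_mem_ge hCu (max m m')
    exact hm' a ((le_max_right _ _).trans ha) haC (hm a ((le_max_left _ _).trans ha) haC)
  have hor : ∀ i, (∃ m, ∀ t, m ≤ t → t ∈ C → pair t i ∈ E) ∨
      (∃ m, ∀ t, m ≤ t → t ∈ C → pair t i ∉ E) := by
    intro i
    rcases hcoh i with ⟨b, hb⟩ | ⟨b, hb⟩
    · exact .inl ⟨b, fun t ht htC => by_contra fun hn => (hb t ⟨htC, hn⟩).not_ge ht⟩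
    · exact .inr ⟨b, fun t ht htC hn => (hb t ⟨htC, hn⟩).not_ge ht⟩
  refine ⟨{i | ∃ m, ∀ t, m ≤ t → t ∈ C → pair t i ∈ E}, ⟨?_, ?_⟩, fun i hi => ?_,
    fun i hi hi' => ?_⟩
  · have : Sg S 2 (fun v : Fin 1 → M => ∃ m, ∀ t, m ≤ t → t ∈ C → pair t (v 0) ∈ E) :=
      Sg.succ_iff₁.2 ⟨fun m v => ∀ t, m ≤ t → t ∈ C → pair t (v 0) ∈ E, inferInstance,
        fun _ => Iff.rfl⟩
    exact this.out
  · have : Sg S 2 (fun v : Fin 1 → M => ∃ m, ∀ t, m ≤ t → t ∈ C → pair t (v 0) ∉ E) :=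
      Sg.succ_iff₁.2 ⟨fun m v => ∀ t, m ≤ t → t ∈ C → pair t (v 0) ∉ E, inferInstance,
        fun _ => Iff.rfl⟩
    exact (this.congr fun v => ⟨fun h => (hor _).resolve_left h, fun h h' => hexcl _ h' h⟩).out
  · exact (h₀ i hi).imp fun m hm t ht _ => hm t ht
  · exact hexcl i hi ((h₁ i hi').imp fun m hm t ht _ => hm t ht)

/-! ### Binary strings -/

/-- `σ` codes a string of length `log₂ p`. Lengths are measured by powers of two, which avoids
exponentiation. -/
def InLevel (p σ : M) : Prop := IsPowTwo p ∧ p ≤ σ ∧ σ < 2 * p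

theorem two_mul_add_inj {a b a' b' : M} (hb : b < 2) (hb' : b' < 2)
    (h : 2 * a + b = 2 * a' + b') : a = a' ∧ b = b' := by
  rcases lt_two_iff.1 hb with rfl | rfl <;> rcases lt_two_iff.1 hb' with rfl | rfl
  · exact ⟨mul_left_cancel₀ (two_ne_zero (α := M)) (by simpa using h), rfl⟩
  · exact absurd (by simpa using h) (two_mul_ne_two_mul_add_one a a')
  · exact absurd (by simpa using h.symm) (two_mul_ne_two_mul_add_one a' a)
  · exact ⟨mul_left_cancel₀ (two_ne_zero (α := M)) (add_right_cancel h), rfl⟩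

theorem InLevel.child {p σ b : M} (S : Set (Set M)) [Fact (ModelsRCA0 S)] (h : InLevel p σ)
    (hb : b < 2) : InLevel (2 * p) (2 * σ + b) := by
  refine ⟨h.1.two_mul S, (mul_le_mul_of_nonneg_left h.2.1 zero_le_two).trans le_self_add, ?_⟩
  refine lt_of_le_of_lt ?_ (two_mul_add_one_lt h.2.2)
  refine add_le_add_right (lt_add_one_iff_le.1 ?_) _
  rwa [one_add_one_eq_two]

theorem exists_inLevel (S : Set (Set M)) [Fact (ModelsRCA0 S)] {σ : M} (hσ : σ ≠ 0) :
    ∃ p, InLevel p σ := by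
  have key : ∀ σ : M, σ ≠ 0 → ∃ p, p ≤ σ ∧ (IsPowTwo p ∧ p ≤ σ ∧ σ < 2 * p) := by
    refine strong_induction S fun σ ih hσ => ?_
    obtain ⟨y, r, hr, hy⟩ := exists_eq_mul_add S (zero_lt_two (α := M)) σ
    rw [mul_comm] at hy
    subst hy
    rcases eq_or_ne y 0 with rfl | hy0
    · rcases lt_two_iff.1 hr with rfl | rfl
      · simp at hσ
      · exact ⟨1, by simp, isPowTwo_one, by simp, by simp⟩
    · have hlt : y < 2 * y + r :=
        (lt_mul_of_one_lt_left (pos_iff_ne_zero.2 hy0) one_lt_two).trans_le le_self_add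
      obtain ⟨p, -, hp⟩ := ih y hlt hy0
      have := InLevel.child S hp hr
      exact ⟨2 * p, this.2.1, this⟩
  obtain ⟨p, -, hp⟩ := key σ hσ
  exact ⟨p, hp⟩

theorem IsPowTwo.two_mul_le (S : Set (Set M)) [Fact (ModelsRCA0 S)] {p q : M} (hp : IsPowTwo p)
    (hq : IsPowTwo q) (h : p < q) : 2 * p ≤ q := by
  obtain ⟨m, hm, rfl⟩ := hp.exists_eq_mul S hq h.le
  rcases hm.eq_one_or S with rfl | ⟨m', hm', rfl, -⟩
  · simp at h
  · rw [mul_comm]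
    exact mul_le_mul_of_nonneg_left
      (le_mul_of_one_le_right zero_le (PMinus.one_le_of_pos _ hm'.pos)) zero_le

theorem InLevel.le_of_lt (S : Set (Set M)) [Fact (ModelsRCA0 S)] {p q σ : M}
    (hp : InLevel p σ) (hq : IsPowTwo q) (h : σ < 2 * q) : p ≤ q := by
  by_contra! hlt
  exact absurd ((hq.two_mul_le S hp.1 hlt).trans hp.2.1) (not_le.2 h)

theorem InLevel.unique (S : Set (Set M)) [Fact (ModelsRCA0 S)] {p q σ : M}
    (hp : InLevel p σ) (hq : InLevel q σ) : p = q :=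
  (hp.le_of_lt S hq.1 hq.2.2).antisymm (hq.le_of_lt S hp.1 hp.2.2)

theorem InLevel.mul_add (S : Set (Set M)) [Fact (ModelsRCA0 S)] {p σ m r : M}
    (h : InLevel p σ) (hm : IsPowTwo m) (hr : r < m) : InLevel (p * m) (σ * m + r) := by
  refine ⟨h.1.mul S hm, (mul_le_mul_of_nonneg_right h.2.1 zero_le).trans le_self_add, ?_⟩
  calc σ * m + r < σ * m + m := add_lt_add_right hr _
    _ = (σ + 1) * m := by ring
    _ ≤ 2 * p * m := mul_le_mul_of_nonneg_right (add_one_le_of_lt h.2.2) zero_le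
    _ = 2 * (p * m) := by ring

theorem InLevel.ne_zero {p σ : M} (h : InLevel p σ) : σ ≠ 0 :=
  (h.1.pos.trans_le h.2.1).ne'

theorem IsPrefix.refl {σ : M} (h : σ ≠ 0) : IsPrefix σ σ :=
  ⟨h, 1, 0, isPowTwo_one, zero_lt_one, by simp⟩

theorem IsPrefix.le {σ τ : M} (h : IsPrefix σ τ) : σ ≤ τ := by
  obtain ⟨-, p, r, hp, -, rfl⟩ := h
  exact (le_mul_of_one_le_right zero_le (PMinus.one_le_of_pos p hp.pos)).trans le_self_add

theorem IsPrefix.trans (S : Set (Set M)) [Fact (ModelsRCA0 S)] {ρ σ τ : M} (h : IsPrefix ρ σ)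
    (h' : IsPrefix σ τ) : IsPrefix ρ τ := by
  obtain ⟨h0, p, r, hp, hr, rfl⟩ := h
  obtain ⟨-, q, s, hq, hs, rfl⟩ := h'
  refine ⟨h0, p * q, r * q + s, hp.mul S hq, ?_, by ring⟩
  calc r * q + s < r * q + q := add_lt_add_right hs _
    _ = (r + 1) * q := by ring
    _ ≤ p * q := mul_le_mul_of_nonneg_right (add_one_le_of_lt hr) zero_le

theorem isPrefix_one {p τ : M} (h : InLevel p τ) : IsPrefix 1 τ := by
  obtain ⟨r, hr⟩ := exists_add_of_le h.2.1
  refine ⟨one_ne_zero, p, r, h.1, ?_, by rw [hr, one_mul]⟩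
  have := h.2.2
  rw [hr, two_mul] at this
  exact lt_of_add_lt_add_left this

theorem isPrefix_child (S : Set (Set M)) [Fact (ModelsRCA0 S)] {σ b : M} (h : σ ≠ 0) (hb : b < 2) :
    IsPrefix σ (2 * σ + b) :=
  ⟨h, 2, b, by simpa using isPowTwo_one.two_mul S, hb, by ring⟩

theorem isPrefix_child_iff (S : Set (Set M)) [Fact (ModelsRCA0 S)] {ρ σ b : M} (hb : b < 2)
    (h : IsPrefix ρ (2 * σ + b)) : ρ = 2 * σ + b ∨ IsPrefix ρ σ := by
  obtain ⟨h0, m, s, hm, hs, h⟩ := h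
  rcases hm.eq_one_or S with rfl | ⟨m, hm', rfl, -⟩
  · have : s = 0 := nonpos_iff_eq_zero.1 (lt_add_one_iff_le.1 (by simpa using hs))
    exact .inl (by simp [h, this])
  · obtain ⟨s', b', hb', rfl⟩ := exists_eq_mul_add S (zero_lt_two (α := M)) s
    obtain ⟨rfl, rfl⟩ := two_mul_add_inj hb hb' (h.trans (by ring : _ = 2 * (ρ * m + s') + b'))
    refine .inr ⟨h0, m, s', hm', ?_, rfl⟩
    by_contra! hle
    have h1 := (mul_le_mul_of_nonneg_left hle (zero_le_two (α := M))).trans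
      (le_self_add : _ ≤ 2 * s' + b)
    rw [mul_comm s'] at hs
    exact absurd hs (not_lt.2 h1)

theorem IsPrefix.eq_of_inLevel (S : Set (Set M)) [Fact (ModelsRCA0 S)] {p σ τ : M}
    (h : IsPrefix σ τ) (hσ : InLevel p σ) (hτ : InLevel p τ) : σ = τ := by
  obtain ⟨h0, m, r, hm, hr, rfl⟩ := h
  have := (hσ.mul_add S hm hr).unique S hτ
  obtain rfl : m = 1 := mul_left_cancel₀ hσ.1.pos.ne' (by rw [this, mul_one])
  have : r = 0 := nonpos_iff_eq_zero.1 (lt_add_one_iff_le.1 (by simpa using hr))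
  simp [this]

theorem IsPrefix.eq_child (S : Set (Set M)) [Fact (ModelsRCA0 S)] {p σ τ : M}
    (h : IsPrefix σ τ) (hσ : InLevel p σ) (hτ : InLevel (2 * p) τ) :
    ∃ b, b < 2 ∧ τ = 2 * σ + b := by
  obtain ⟨h0, m, r, hm, hr, rfl⟩ := h
  have := (hσ.mul_add S hm hr).unique S hτ
  obtain rfl : m = 2 := mul_left_cancel₀ hσ.1.pos.ne' (by rw [this, mul_comm])
  exact ⟨r, hr, by ring⟩

/-- Between a prefix and the string there are prefixes of every intermediate length. -/
theorem IsPrefix.exists_between (S : Set (Set M)) [Fact (ModelsRCA0 S)] {p q r ρ τ : M}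
    (h : IsPrefix ρ τ) (hρ : InLevel r ρ) (hτ : InLevel q τ) (hp : IsPowTwo p) (hrp : r ≤ p)
    (hpq : p ≤ q) : ∃ σ, InLevel p σ ∧ IsPrefix ρ σ ∧ IsPrefix σ τ := by
  obtain ⟨h0, m, s, hm, hs, rfl⟩ := h
  obtain ⟨n, hn, rfl⟩ := hρ.1.exists_eq_mul S hp hrp
  obtain ⟨m', hm', rfl⟩ := hp.exists_eq_mul S hτ.1 hpq
  have hlev := (hρ.mul_add S hm hs).unique S hτ
  obtain rfl : m = n * m' := mul_left_cancel₀ hρ.1.pos.ne' (by rw [hlev, mul_assoc])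
  obtain ⟨s₁, s₂, hs₂, rfl⟩ := exists_eq_mul_add S hm'.pos s
  have hs₁ : s₁ < n := by
    by_contra! hle
    exact absurd hs (not_lt.2 ((mul_le_mul_of_nonneg_right hle zero_le).trans le_self_add))
  have hσ := hρ.mul_add S hn hs₁
  exact ⟨ρ * n + s₁, hσ, ⟨h0, n, s₁, hn, hs₁, rfl⟩, hσ.ne_zero, m', s₂, hm', hs₂, by ring⟩

theorem InLevel.exists_prefix (S : Set (Set M)) [Fact (ModelsRCA0 S)] {p q τ : M}
    (hτ : InLevel q τ) (hp : IsPowTwo p) (hpq : p ≤ q) : ∃ σ, InLevel p σ ∧ IsPrefix σ τ := by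
  obtain ⟨σ, h, -, h'⟩ := (isPrefix_one hτ).exists_between S ⟨isPowTwo_one, le_rfl, by simp⟩ hτ hp
    (PMinus.one_le_of_pos p hp.pos) hpq
  exact ⟨σ, h, h'⟩

instance Sg.isPrefix {t s : (Fin k → M) → M} [ht : TermFn t] [hs : TermFn s] :
    Sg S 0 (fun v => IsPrefix (t v) (s v)) := by
  have : TermFn (fun w : Fin (k + 1 + 1) → M => t (fun i => w i.succ.succ)) :=
    ht.comp fun i => TermFn.var i.succ.succ
  have : TermFn (fun w : Fin (k + 1 + 1) → M => s (fun i => w i.succ.succ)) :=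
    hs.comp fun i => TermFn.var i.succ.succ
  have : TermFn (fun w : Fin (k + 1) → M => s (fun i => w i.succ)) :=
    hs.comp fun i => TermFn.var i.succ
  have key : ∀ σ τ : M, IsPrefix σ τ ↔
      ¬ σ = 0 ∧ ∃ p, p ≤ τ ∧ ∃ r, r ≤ τ ∧ IsPowTwo p ∧ r < p ∧ τ = σ * p + r := by
    refine fun σ τ => and_congr_right fun h0 => ⟨?_, ?_⟩
    · rintro ⟨p, r, hp, hr, rfl⟩
      exact ⟨p, (le_mul_of_one_le_left zero_le
        (PMinus.one_le_of_pos σ (pos_iff_ne_zero.2 h0))).trans le_self_add, r, le_add_self,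
        hp, hr, rfl⟩
    · rintro ⟨p, -, r, -, h⟩
      exact ⟨p, r, h⟩
  simp only [key]
  infer_instance

/-! ### Strings that follow a set -/

/-- The digits of the string `σ` follow the set `X`: the prefix `ρ` is continued by `1` exactly if
`ρ ∈ X`. The code `0`, which codes no string, is left out as a value of `ρ`. -/
def Agree (X : Set M) (σ : M) : Prop :=
  σ ≠ 0 ∧ ∀ ρ, ρ < σ → ρ ≠ 0 → (IsPrefix (2 * ρ + 1) σ → ρ ∈ X) ∧ (IsPrefix (2 * ρ) σ → ρ ∉ X)

variable {X : Set M}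

theorem Agree.mem {ρ σ : M} (h : Agree X σ) (h0 : ρ ≠ 0) (hp : IsPrefix (2 * ρ + 1) σ) : ρ ∈ X :=
  (h.2 ρ (((le_mul_of_one_le_left zero_le one_le_two).trans_lt (lt_add_one _)).trans_le hp.le)
    h0).1 hp

theorem Agree.not_mem {ρ σ : M} (h : Agree X σ) (h0 : ρ ≠ 0) (hp : IsPrefix (2 * ρ) σ) : ρ ∉ X :=
  (h.2 ρ ((lt_mul_of_one_lt_left (pos_iff_ne_zero.2 h0) one_lt_two).trans_le hp.le) h0).2 hp

theorem Agree.of_isPrefix (S : Set (Set M)) [Fact (ModelsRCA0 S)] {ρ σ : M} (h : Agree X σ)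
    (hp : IsPrefix ρ σ) : Agree X ρ :=
  ⟨hp.1, fun _ _ h0 => ⟨fun h' => h.mem h0 (h'.trans S hp), fun h' => h.not_mem h0 (h'.trans S hp)⟩⟩

theorem agree_one : Agree X (1 : M) :=
  ⟨one_ne_zero, fun ρ hρ h0 => absurd (PMinus.one_le_of_pos ρ (pos_iff_ne_zero.2 h0)) hρ.not_ge⟩

theorem Agree.child (S : Set (Set M)) [Fact (ModelsRCA0 S)] {σ b : M} (h : Agree X σ) (hb : b < 2)
    (hX : b = 1 ↔ σ ∈ X) : Agree X (2 * σ + b) := by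
  refine ⟨fun h0 => h.1 (by simpa using (add_eq_zero.1 h0).1),
    fun ρ _ h0 => ⟨fun hp => ?_, fun hp => ?_⟩⟩
  · rcases isPrefix_child_iff S hb hp with heq | hp
    · obtain ⟨rfl, rfl⟩ := two_mul_add_inj one_lt_two hb heq
      exact hX.1 rfl
    · exact h.mem h0 hp
  · rcases isPrefix_child_iff S hb hp with heq | hp
    · obtain ⟨rfl, rfl⟩ := two_mul_add_inj zero_lt_two hb ((add_zero _).trans heq)
      exact fun hmem => zero_ne_one (hX.2 hmem)
    · exact h.not_mem h0 hp

instance Sg.agree [Fact (ModelsRCA0 S)] [Fact (BSigma S 2)] [SgSet S 2 X] [PgSet S 2 X]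
    {t : (Fin k → M) → M} [ht : TermFn t] : Sg S 2 (fun v => Agree X (t v)) := by
  have : TermFn (fun w : Fin (k + 1) → M => t (fun i => w i.succ)) :=
    ht.comp fun i => TermFn.var i.succ
  simp only [Agree, ne_eq]
  infer_instance

instance Pg.agree [Fact (ModelsRCA0 S)] [Fact (BSigma S 2)] [SgSet S 2 X] [PgSet S 2 X]
    {t : (Fin k → M) → M} [ht : TermFn t] : Pg S 2 (fun v => Agree X (t v)) := by
  have : TermFn (fun w : Fin (k + 1) → M => t (fun i => w i.succ)) :=
    ht.comp fun i => TermFn.var i.succ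
  simp only [Agree, ne_eq]
  infer_instance

theorem IsPowTwo.induction_delta_two (S : Set (Set M)) [Fact (ModelsRCA0 S)] [Fact (BSigma S 2)]
    {P : M → Prop} [hP : Sg S 2 (fun v : Fin 1 → M => P (v 0))]
    [hP' : Pg S 2 (fun v : Fin 1 → M => P (v 0))] (h1 : P 1)
    (h2 : ∀ p, IsPowTwo p → P p → P (2 * p)) : ∀ p, IsPowTwo p → P p := by
  by_contra! hcon
  obtain ⟨p, ⟨hp, hPp⟩, hmin⟩ := delta_two_least (S := S) (P := fun p => IsPowTwo p ∧ ¬ P p) hcon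
  rcases hp.eq_one_or S with rfl | ⟨q, hq, rfl, hlt⟩
  · exact hPp h1
  · exact hPp (h2 q hq (not_not.1 fun h => hmin q hlt ⟨hq, h⟩))

/-- Every length has a string that follows `X`; a `Δ⁰₂` induction. -/
theorem exists_agree (S : Set (Set M)) [Fact (ModelsRCA0 S)] [Fact (BSigma S 2)]
    [SgSet S 2 X] [PgSet S 2 X] {p : M} (hp : IsPowTwo p) : ∃ σ, InLevel p σ ∧ Agree X σ := by
  have key : ∀ p, IsPowTwo p → ∃ σ, σ < 2 * p ∧ p ≤ σ ∧ Agree X σ := by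
    refine IsPowTwo.induction_delta_two S ⟨1, by simp, le_rfl, agree_one⟩ ?_
    rintro p hp ⟨σ, hσ, hpσ, h⟩
    by_cases hX : σ ∈ X
    · have := InLevel.child S ⟨hp, hpσ, hσ⟩ one_lt_two
      exact ⟨_, this.2.2, this.2.1, h.child S one_lt_two (by simpa)⟩
    · have := InLevel.child S ⟨hp, hpσ, hσ⟩ zero_lt_two
      exact ⟨_, this.2.2, this.2.1, h.child S zero_lt_two (by simpa)⟩
  obtain ⟨σ, h1, h2, h3⟩ := key p hp
  exact ⟨σ, ⟨hp, h2, h1⟩, h3⟩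

theorem InLevel.eq_child (S : Set (Set M)) [Fact (ModelsRCA0 S)] {p τ : M} (hp : IsPowTwo p)
    (h : InLevel (2 * p) τ) : ∃ σ b, InLevel p σ ∧ b < 2 ∧ τ = 2 * σ + b := by
  obtain ⟨σ, hσ, hpre⟩ := h.exists_prefix S hp (le_mul_of_one_le_left zero_le one_le_two)
  obtain ⟨b, hb, h⟩ := hpre.eq_child S hσ h
  exact ⟨σ, b, hσ, hb, h⟩

theorem Agree.last_digit {σ b : M} (h0 : σ ≠ 0) (hb : b < 2) (h : Agree X (2 * σ + b)) :
    b = 1 ↔ σ ∈ X := by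
  rcases lt_two_iff.1 hb with rfl | rfl
  · have := h.not_mem h0 (by rw [add_zero]; exact IsPrefix.refl (by simpa))
    simpa
  · have := h.mem h0 (IsPrefix.refl h.1)
    simpa

theorem Agree.unique (S : Set (Set M)) [Fact (ModelsRCA0 S)] [Fact (BSigma S 2)]
    [SgSet S 2 X] [PgSet S 2 X] {p σ τ : M} (hσ : InLevel p σ) (hτ : InLevel p τ)
    (h : Agree X σ) (h' : Agree X τ) : σ = τ := by
  have key : ∀ p, IsPowTwo p → ∀ σ, σ < 2 * p → ∀ τ, τ < 2 * p → p ≤ σ → p ≤ τ → Agree X σ →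
      Agree X τ → σ = τ := by
    refine IsPowTwo.induction_delta_two S ?_ ?_
    · intro σ hσ τ hτ hσ' hτ' _ _
      rw [mul_one, ← one_add_one_eq_two, lt_add_one_iff_le] at hσ hτ
      rw [hσ.antisymm hσ', hτ.antisymm hτ']
    · intro p hp ih σ hσ τ hτ hσ' hτ' h h'
      obtain ⟨σ, b, hlσ, hb, rfl⟩ := InLevel.eq_child S hp ⟨hp.two_mul S, hσ', hσ⟩
      obtain ⟨τ, c, hlτ, hc, rfl⟩ := InLevel.eq_child S hp ⟨hp.two_mul S, hτ', hτ⟩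
      obtain rfl := ih σ hlσ.2.2 τ hlτ.2.2 hlσ.2.1 hlτ.2.1
        (h.of_isPrefix S (isPrefix_child S hlσ.ne_zero hb))
        (h'.of_isPrefix S (isPrefix_child S hlτ.ne_zero hc))
      have := (h.last_digit hlσ.ne_zero hb).trans (h'.last_digit hlσ.ne_zero hc).symm
      rcases lt_two_iff.1 hb with rfl | rfl <;> rcases lt_two_iff.1 hc with rfl | rfl <;> simp_all
  exact key p hσ.1 σ hσ.2.2 τ hτ.2.2 hσ.2.1 hτ.2.1 h h'

theorem isPath_agree (S : Set (Set M)) [Fact (ModelsRCA0 S)] [Fact (BSigma S 2)]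
    [SgSet S 2 X] [PgSet S 2 X] : IsPath {σ | Agree X σ} := by
  have key : ∀ σ τ p q, InLevel p σ → InLevel q τ → p ≤ q → Agree X σ → Agree X τ →
      IsPrefix σ τ := by
    intro σ τ p q hσ hτ hpq h h'
    obtain ⟨ρ, hρ, hpre⟩ := hτ.exists_prefix S hσ.1 hpq
    rwa [h.unique S hσ hρ (h'.of_isPrefix S hpre)]
  refine ⟨⟨fun σ h => h.1, fun σ τ h h' => h'.of_isPrefix S h⟩, fun σ τ h h' => ?_⟩
  obtain ⟨p, hp⟩ := exists_inLevel S h.1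
  obtain ⟨q, hq⟩ := exists_inLevel S h'.1
  rcases le_total p q with hle | hle
  · exact .inl (key σ τ p q hp hq hle h h')
  · exact .inr (key τ σ q p hq hp hle h' h)

theorem exists_isPowTwo_gt (S : Set (Set M)) [Fact (ModelsRCA0 S)] (b : M) :
    ∃ p, IsPowTwo p ∧ b < p := by
  rcases eq_or_ne b 0 with rfl | h
  · exact ⟨1, isPowTwo_one, zero_lt_one⟩
  · obtain ⟨p, hp, -, h⟩ := exists_inLevel S h
    exact ⟨2 * p, hp.two_mul S, h⟩

theorem unbounded_agree (S : Set (Set M)) [Fact (ModelsRCA0 S)] [Fact (BSigma S 2)]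
    [SgSet S 2 X] [PgSet S 2 X] : Unbounded {σ | Agree X σ} := by
  rintro ⟨b, hb⟩
  obtain ⟨p, hp, hbp⟩ := exists_isPowTwo_gt S b
  obtain ⟨σ, hσ, h⟩ := exists_agree (X := X) S hp
  exact absurd (hb σ h) (not_lt.2 (hbp.le.trans hσ.2.1))

theorem exists_mem_inLevel (S : Set (Set M)) [Fact (ModelsRCA0 S)] {T : Set M} (hT : IsBinaryTree T)
    (hTu : Unbounded T) {p : M} (hp : IsPowTwo p) : ∃ σ, InLevel p σ ∧ σ ∈ T := by
  obtain ⟨τ, hτ, hle⟩ := exists_mem_ge hTu p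
  obtain ⟨q, hq⟩ := exists_inLevel S (hT.1 τ hτ)
  obtain ⟨σ, hσ, hpre⟩ := hq.exists_prefix S hp (by
    by_contra! hlt
    exact absurd (hq.2.2.trans_le (hq.1.two_mul_le S hp hlt)) (not_lt.2 hle))
  exact ⟨σ, hσ, hT.2 σ τ hpre hτ⟩

/-! ### Separating sets give paths -/

/-- `σ` has an extension in `T` of length `log₂ p`. -/
def Extendible (T : Set M) (p σ : M) : Prop := ∃ τ, τ < 2 * p ∧ p ≤ τ ∧ τ ∈ T ∧ IsPrefix σ τ

variable {T : Set M}

instance Sg.extendible [Fact (ModelsRCA0 S)] [Fact (BSigma S 2)] [SgSet S 2 T] [PgSet S 2 T]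
    {t s : (Fin k → M) → M} [ht : TermFn t] [hs : TermFn s] :
    Sg S 2 (fun v => Extendible T (t v) (s v)) := by
  have : TermFn (fun w : Fin (k + 1) → M => t (fun i => w i.succ)) :=
    ht.comp fun i => TermFn.var i.succ
  have : TermFn (fun w : Fin (k + 1) → M => s (fun i => w i.succ)) :=
    hs.comp fun i => TermFn.var i.succ
  simp only [Extendible]
  infer_instance

instance Pg.extendible [Fact (ModelsRCA0 S)] [Fact (BSigma S 2)] [SgSet S 2 T] [PgSet S 2 T]
    {t s : (Fin k → M) → M} [ht : TermFn t] [hs : TermFn s] :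
    Pg S 2 (fun v => Extendible T (t v) (s v)) := by
  have : TermFn (fun w : Fin (k + 1) → M => t (fun i => w i.succ)) :=
    ht.comp fun i => TermFn.var i.succ
  have : TermFn (fun w : Fin (k + 1) → M => s (fun i => w i.succ)) :=
    hs.comp fun i => TermFn.var i.succ
  simp only [Extendible]
  infer_instance

/-- An extension can be cut down to any length that is at least that of `σ`. -/
theorem Extendible.anti (S : Set (Set M)) [Fact (ModelsRCA0 S)] (hT : IsBinaryTree T) {p q σ : M}
    (hp : IsPowTwo p) (hq : IsPowTwo q) (hpq : p ≤ q) (hσ : σ < 2 * p) (h : Extendible T q σ) :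
    Extendible T p σ := by
  obtain ⟨τ, hτ, hqτ, hτT, hpre⟩ := h
  obtain ⟨r, hr⟩ := exists_inLevel S hpre.1
  obtain ⟨ρ, hρ, hσρ, hρτ⟩ :=
    hpre.exists_between S hr ⟨hq, hqτ, hτ⟩ hp (hr.le_of_lt S hp hσ) hpq
  exact ⟨ρ, hρ.2.2, hρ.2.1, hT.2 ρ τ hρτ hτT, hσρ⟩

theorem Extendible.lt {p σ : M} (h : Extendible T p σ) : σ < 2 * p :=
  let ⟨_, hτ, _, _, hpre⟩ := h
  hpre.le.trans_lt hτ

theorem Extendible.exists_child (S : Set (Set M)) [Fact (ModelsRCA0 S)] {p q σ : M}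
    (hσ : InLevel p σ) (hq : IsPowTwo q) (hpq : 2 * p ≤ q) (h : Extendible T q σ) :
    ∃ b, b < 2 ∧ Extendible T q (2 * σ + b) := by
  obtain ⟨τ, hτ, hqτ, hτT, hpre⟩ := h
  obtain ⟨ρ, hρ, hσρ, hρτ⟩ := hpre.exists_between S hσ ⟨hq, hqτ, hτ⟩ (hσ.1.two_mul S)
    (le_mul_of_one_le_left zero_le one_le_two) hpq
  obtain ⟨b, hb, rfl⟩ := hσρ.eq_child S hσ hρ
  exact ⟨b, hb, τ, hτ, hqτ, hτT, hρτ⟩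

/-- Separate the strings whose left child dies out in the tree before the right one from those for
which it is the other way round, and follow the separating set. -/
theorem SigmaTwoSeparation.deltaTwoTreesHavePaths [Fact (ModelsRCA0 S)] [Fact (BSigma S 2)]
    (h : SigmaTwoSeparation S) : DeltaTwoTreesHavePaths S := by
  intro T hTΔ hT hTu
  have := SgSet.mk hTΔ.1
  have := PgSet.mk hTΔ.2
  have h₀ : Sg S 2 (fun v : Fin 1 → M => ∃ p, IsPowTwo p ∧
    ¬ Extendible T p (2 * v 0) ∧ Extendible T p (2 * v 0 + 1)) := inferInstance
  have h₁ : Sg S 2 (fun v : Fin 1 → M => ∃ p, IsPowTwo p ∧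
    ¬ Extendible T p (2 * v 0 + 1) ∧ Extendible T p (2 * v 0)) := inferInstance
  obtain ⟨D, hDΔ, hD₀, hD₁⟩ := h
    {σ | ∃ p, IsPowTwo p ∧ ¬ Extendible T p (2 * σ) ∧ Extendible T p (2 * σ + 1)}
    {σ | ∃ p, IsPowTwo p ∧ ¬ Extendible T p (2 * σ + 1) ∧ Extendible T p (2 * σ)}
    h₀.out h₁.out (by
      rw [Set.disjoint_left]
      rintro σ ⟨p, hp, hn, hy⟩ ⟨q, hq, hn', hy'⟩
      rcases le_total p q with hpq | hqp
      · exact hn (hy'.anti S hT hp hq hpq ((lt_add_one _).trans hy.lt))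
      · exact hn' (hy.anti S hT hq hp hqp
          (two_mul_add_one_lt (lt_of_mul_lt_mul_left hy'.lt zero_le_two))))
  have := SgSet.mk hDΔ.1
  have := PgSet.mk hDΔ.2
  have hP : Sg S 2 (fun v : Fin 1 → M => Agree D (v 0)) := inferInstance
  have hP' : Pg S 2 (fun v : Fin 1 → M => Agree D (v 0)) := inferInstance
  refine ⟨{σ | Agree D σ}, ⟨hP.out, hP'.out.out⟩, isPath_agree S, unbounded_agree S,
    fun σ hσ => ?_⟩
  obtain ⟨q, hq⟩ := exists_inLevel S hσ.1
  have key : ∀ p, IsPowTwo p → p ≤ q → ∀ ρ, ρ < 2 * p → p ≤ ρ → IsPrefix ρ σ →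
      Extendible T q ρ := by
    refine IsPowTwo.induction_delta_two S ?_ ?_
    · intro _ ρ hρ hρ' _
      obtain ⟨τ, hτ, hτT⟩ := exists_mem_inLevel S hT hTu hq.1
      rw [mul_one, ← one_add_one_eq_two, lt_add_one_iff_le] at hρ
      rw [hρ.antisymm hρ']
      exact ⟨τ, hτ.2.2, hτ.2.1, hτT, isPrefix_one hτ⟩
    · intro p hp ih hpq ρ hρ hρ' hpre
      obtain ⟨ρ, b, hlρ, hb, rfl⟩ := InLevel.eq_child S hp ⟨hp.two_mul S, hρ', hρ⟩
      have hext := ih ((le_mul_of_one_le_left zero_le one_le_two).trans hpq) ρ hlρ.2.2 hlρ.2.1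
        ((isPrefix_child S hlρ.ne_zero hb).trans S hpre)
      obtain ⟨c, hc, hext⟩ := hext.exists_child S hlρ hq.1 hpq
      by_contra hn
      rcases lt_two_iff.1 hb with rfl | rfl <;> rcases lt_two_iff.1 hc with rfl | rfl
      · exact hn hext
      · rw [add_zero] at hn hpre
        exact hσ.not_mem hlρ.ne_zero hpre (hD₀ ⟨q, hq.1, hn, hext⟩)
      · rw [add_zero] at hext
        exact hD₁ (hσ.mem hlρ.ne_zero hpre) ⟨q, hq.1, hn, hext⟩
      · exact hn hext
  obtain ⟨τ, hτ, hqτ, hτT, hpre⟩ := key q hq.1 le_rfl σ hq.2.2 hq.2.1 (IsPrefix.refl hσ.1)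
  rwa [hpre.eq_of_inLevel S hq ⟨hq.1, hqτ, hτ⟩]

/-! ### Coded finite sets and exponentiation -/

/-- The number `c`, with modulus `d`, codes the set of the `u` such that `1 + (u + 1) d` divides
`c`. -/
def Coded (c d u : M) : Prop := 1 + (u + 1) * d ∣ c

theorem dvd_of_dvd_add {m a b : M} (h : m ∣ a + b) (ha : m ∣ a) : m ∣ b := by
  obtain ⟨t, rfl⟩ := ha
  obtain ⟨s, hs⟩ := h
  rcases eq_or_ne m 0 with rfl | hm
  · rw [zero_mul, zero_mul, zero_add] at hs
    rw [hs]
  · have hts : t ≤ s := by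
      by_contra! hlt
      exact absurd (hs ▸ le_self_add : m * t ≤ m * s)
        (not_le.2 (mul_lt_mul_of_pos_left hlt (pos_iff_ne_zero.2 hm)))
    obtain ⟨r, rfl⟩ := exists_add_of_le hts
    rw [mul_add] at hs
    exact ⟨r, add_left_cancel hs⟩

instance Sg.coded {t s r : (Fin k → M) → M} [ht : TermFn t] [hs : TermFn s] [hr : TermFn r] :
    Sg S 0 (fun v => Coded (t v) (s v) (r v)) := by
  simp only [Coded]
  infer_instance

/-- If all positive numbers below `N` divide `d`, then the moduli `1 + (u + 1) d` with `u < N` are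
pairwise coprime, in the form that a modulus dividing `c` times another modulus divides `c`. -/
theorem Coded.of_mul {c d e f N : M} (hd : ∀ j, j < N → j ≠ 0 → j ∣ d) (he : e < N) (hf : f < N)
    (hne : e ≠ f) (h : Coded (c * (1 + (f + 1) * d)) d e) : Coded c d e := by
  obtain ⟨j, hj, hj0, hdvd⟩ : ∃ j, j < N ∧ j ≠ 0 ∧ Coded (c * j) d e := by
    have h' : Coded ((e + 1) * (c * (1 + (f + 1) * d))) d e := Dvd.dvd.mul_left h _
    rcases hne.lt_or_gt with hlt | hlt
    · obtain ⟨j, rfl⟩ := exists_add_of_le hlt.le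
      refine ⟨j, le_add_self.trans_lt hf, ?_, dvd_of_dvd_add ?_ h'⟩
      · rintro rfl
        simp at hlt
      · exact ⟨c * (e + j + 1), by ring⟩
    · obtain ⟨j, rfl⟩ := exists_add_of_le hlt.le
      refine ⟨j, le_add_self.trans_lt he, ?_, dvd_of_dvd_add
        (a := c * (f + 1) * (1 + (f + j + 1) * d)) ?_ (dvd_mul_left _ _)⟩
      · rintro rfl
        simp at hlt
      · refine (h'.trans (dvd_of_eq ?_))
        ring
  obtain ⟨d', rfl⟩ := hd j hj hj0
  refine dvd_of_dvd_add (a := c * j * (d' * (e + 1))) ?_ (hdvd.mul_right _)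
  exact ⟨c, by ring⟩

theorem exists_common_multiple (S : Set (Set M)) [Fact (ModelsRCA0 S)] (N : M) :
    ∃ d, d ≠ 0 ∧ ∀ j, j < N → j ≠ 0 → j ∣ d := by
  have key : ∀ N : M, ∃ d, ¬ d = 0 ∧ ∀ j, j < N → ¬ j = 0 → j ∣ d := by
    refine sigma_one_induction (S := S) ⟨1, one_ne_zero, fun j hj => absurd hj not_lt_zero⟩ ?_
    rintro N ⟨d, hd, h⟩
    rcases eq_or_ne N 0 with rfl | hN
    · refine ⟨1, one_ne_zero, fun j hj hj0 => absurd ?_ hj0⟩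
      exact nonpos_iff_eq_zero.1 (lt_add_one_iff_le.1 hj)
    · refine ⟨d * N, mul_ne_zero hd hN, fun j hj hj0 => ?_⟩
      rcases (lt_add_one_iff_le.1 hj).eq_or_lt with rfl | hlt
      · exact dvd_mul_left _ _
      · exact (h j hlt hj0).mul_right N
  exact key N

/-- Every bounded part of a set definable by a bounded formula is coded by numbers. -/
theorem exists_code (S : Set (Set M)) [Fact (ModelsRCA0 S)] {P : M → Prop}
    [hP : Sg S 0 (fun v : Fin 1 → M => P (v 0))] (N : M) :
    ∃ c d, ∀ u, u < N → (Coded c d u ↔ P u) := by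
  have inst {m : ℕ} (t : (Fin m → M) → M) [ht : TermFn t] : Sg S 0 (fun w => P (t w)) :=
    hP.comp (g := fun _ => t) (fun _ => ht)
  obtain ⟨d, hd0, hd⟩ := exists_common_multiple S N
  have key : ∀ n, ∃ c, ∀ u, u < N → (Coded c d u ↔ P u ∧ u < n) := by
    refine sigma_one_induction (S := S)
      ⟨1, fun u _ => ⟨fun h => ?_, fun h => absurd h.2 not_lt_zero⟩⟩ ?_
    · refine absurd (le_of_dvd_of_pos h zero_lt_one) (not_le.2 ?_)
      exact lt_add_of_pos_right 1 (mul_pos (pos_iff_ne_zero.2 (by simp)) (pos_iff_ne_zero.2 hd0))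
    · rintro n ⟨c, hc⟩
      by_cases hn : n < N ∧ P n
      · refine ⟨c * (1 + (n + 1) * d), fun u hu => ?_⟩
        rcases eq_or_ne u n with rfl | hne
        · exact ⟨fun _ => ⟨hn.2, lt_add_one _⟩, fun _ => dvd_mul_left _ _⟩
        · rw [lt_add_one_iff_le, le_iff_eq_or_lt, or_iff_right hne, ← hc u hu]
          exact ⟨fun h => h.of_mul hd hu hn.1 hne, fun h => h.mul_right _⟩
      · refine ⟨c, fun u hu => (hc u hu).trans (and_congr_right fun hPu => ?_)⟩
        rw [lt_add_one_iff_le, le_iff_eq_or_lt, or_iff_right]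
        rintro rfl
        exact hn ⟨hu, hPu⟩
  obtain ⟨c, hc⟩ := key N
  exact ⟨c, d, fun u hu => (hc u hu).trans (and_iff_left hu)⟩

/-- The coded set, below `⟨x, y⟩`, contains `⟨x, y⟩` and consists of computations of powers of
two, each element being `⟨0, 1⟩` or of the form `⟨j + 1, 2 p⟩` with `⟨j, p⟩` in the set. So `y` is
two to the power `x`. -/
def ExpCode (c d x y : M) : Prop := Coded c d (pair x y) ∧ ∀ u, u ≤ pair x y → Coded c d u →
  u = pair 0 1 ∨ ∃ j, j ≤ u ∧ ∃ p, p ≤ u ∧ u = pair (j + 1) (2 * p) ∧ Coded c d (pair j p)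

theorem ExpCode.functional (S : Set (Set M)) [Fact (ModelsRCA0 S)] {c d x y c' d' y' : M}
    (h : ExpCode c d x y) (h' : ExpCode c' d' x y') : y = y' := by
  have key : ∀ j, ∀ p, p ≤ pair x y → ∀ p', p' ≤ pair x y' → pair j p ≤ pair x y →
      pair j p' ≤ pair x y' → Coded c d (pair j p) → Coded c' d' (pair j p') → p = p' := by
    refine sigma_one_induction (S := S) ?_ ?_
    · intro p _ p' _ hp hp' hc hc'
      rcases h.2 _ hp hc with heq | ⟨j, -, q, -, heq, -⟩
      · rcases h'.2 _ hp' hc' with heq' | ⟨j, -, q, -, heq', -⟩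
        · rw [(pair_inj heq).2, (pair_inj heq').2]
        · exact absurd (pair_inj heq').1.symm (by simp)
      · exact absurd (pair_inj heq).1.symm (by simp)
    · intro j ih p _ p' _ hp hp' hc hc'
      rcases h.2 _ hp hc with heq | ⟨j₁, -, q, -, heq, hcq⟩
      · exact absurd (pair_inj heq).1 (by simp)
      · rcases h'.2 _ hp' hc' with heq' | ⟨j₂, -, q', -, heq', hcq'⟩
        · exact absurd (pair_inj heq').1 (by simp)
        · obtain ⟨hj, rfl⟩ := pair_inj heq
          obtain ⟨hj', rfl⟩ := pair_inj heq'
          obtain rfl := add_right_cancel hj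
          obtain rfl := add_right_cancel hj'
          have hle : ∀ q : M, pair j q ≤ pair (j + 1) (2 * q) := fun q =>
            pair_mono le_self_add (le_mul_of_one_le_left zero_le one_le_two)
          have hq := (hle q).trans hp
          have hq' := (hle q').trans hp'
          rw [ih q ((right_le_pair _ _).trans hq) q' ((right_le_pair _ _).trans hq') hq hq' hcq
            hcq']
  exact key x y (right_le_pair x y) y' (right_le_pair x y') le_rfl le_rfl h.1 h'.1

theorem exists_expCode_zero (S : Set (Set M)) [Fact (ModelsRCA0 S)] :
    ∃ c d : M, ExpCode c d 0 1 := by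
  obtain ⟨c, d, h⟩ := exists_code S (P := fun u => u = pair 0 1) (pair 0 1 + 1)
  exact ⟨c, d, (h _ (lt_add_one _)).2 rfl,
    fun u hu hc => .inl ((h u (lt_add_one_iff_le.2 hu)).1 hc)⟩

theorem ExpCode.exists_succ (S : Set (Set M)) [Fact (ModelsRCA0 S)] {c d x y : M}
    (h : ExpCode c d x y) : ∃ c' d', ExpCode c' d' (x + 1) (2 * y) := by
  have hle : ∀ x y : M, pair x y ≤ pair (x + 1) (2 * y) := fun x y =>
    pair_mono le_self_add (le_mul_of_one_le_left zero_le one_le_two)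
  obtain ⟨c', d', h'⟩ := exists_code S
    (P := fun u => (u ≤ pair x y ∧ Coded c d u) ∨ u = pair (x + 1) (2 * y))
    (pair (x + 1) (2 * y) + 1)
  simp only [lt_add_one_iff_le] at h'
  refine ⟨c', d', (h' _ le_rfl).2 (.inr rfl), fun u hu hc => ?_⟩
  rcases (h' u hu).1 hc with ⟨hu', hc⟩ | rfl
  · rcases h.2 u hu' hc with heq | ⟨j, hj, p, hp, rfl, hcp⟩
    · exact .inl heq
    · refine .inr ⟨j, hj, p, hp, rfl,
        (h' _ ((hle j p).trans hu)).2 (.inl ⟨(hle j p).trans hu', hcp⟩)⟩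
  · exact .inr ⟨x, le_self_add.trans (left_le_pair _ _), y,
      (le_mul_of_one_le_left zero_le one_le_two).trans (right_le_pair _ _), rfl,
      (h' _ (hle x y)).2 (.inl ⟨le_rfl, h.1⟩)⟩

instance Sg.expCode [Fact (ModelsRCA0 S)] {t s r q : (Fin k → M) → M} [ht : TermFn t]
    [hs : TermFn s] [hr : TermFn r] [hq : TermFn q] :
    Sg S 0 (fun v => ExpCode (t v) (s v) (r v) (q v)) := by
  have h : Sg S 0 (fun v : Fin 4 → M => ExpCode (v 0) (v 1) (v 2) (v 3)) := by
    simp only [ExpCode]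
    infer_instance
  exact h.comp (g := ![t, s, r, q]) (fun i => by fin_cases i <;> assumption)

/-- Exponentiation to base two exists, and its graph is a member of `S`. -/
theorem exists_exp (S : Set (Set M)) [Fact (ModelsRCA0 S)] : ∃ (e : M → M) (G : Set M), G ∈ S ∧
    e 0 = 1 ∧ (∀ x, e (x + 1) = 2 * e x) ∧ ∀ x y, pair x y ∈ G ↔ y = e x := by
  have total : ∀ x : M, ∃ y c d, ExpCode c d x y := by
    refine sigma_one_induction (S := S) ⟨1, exists_expCode_zero S⟩ ?_
    rintro x ⟨y, c, d, h⟩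
    exact ⟨2 * y, h.exists_succ S⟩
  choose e c d he using total
  have hiff : ∀ x y, y = e x ↔ ∃ c d, ExpCode c d x y := fun x y =>
    ⟨fun h => ⟨c x, d x, h ▸ he x⟩, fun ⟨c', d', h⟩ => h.functional S (he x)⟩
  have hiff' : ∀ x y, ¬ y = e x ↔ ∃ z, ¬ y = z ∧ ∃ c d, ExpCode c d x z := fun x y => by
    simp only [← hiff]
    simp
  have h1 : Sg S 1 (fun v : Fin 2 → M => v 1 = e (v 0)) := by
    simp only [hiff]
    infer_instance
  have h2 : Pg S 1 (fun v : Fin 2 → M => v 1 = e (v 0)) := by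
    constructor
    simp only [hiff']
    infer_instance
  obtain ⟨G, hG, h⟩ := exists_pair_mem_iff (S := S) (θ := fun x y => y = e x)
  refine ⟨e, G, hG, ?_, fun x => ?_, h⟩
  · exact ((hiff 0 1).2 (exists_expCode_zero S)).symm
  · exact ((hiff _ _).2 ((he x).exists_succ S)).symm

/-! ### Paths give cohesive sets -/

theorem exists_exp_isPowTwo (S : Set (Set M)) [Fact (ModelsRCA0 S)] :
    ∃ (e : M → M) (G : Set M), G ∈ S ∧ (∀ x y, pair x y ∈ G ↔ y = e x) ∧ (∀ x, IsPowTwo (e x)) ∧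
      ∀ x y, x < y → 2 * e x ≤ e y := by
  obtain ⟨e, G, hG, h0, hs, h⟩ := exists_exp S
  have := SgSet.of_mem hG
  refine ⟨e, G, hG, h, ?_, ?_⟩
  · have key : ∀ x, ∃ y, pair x y ∈ G ∧ IsPowTwo y := by
      refine sigma_one_induction (S := S) ⟨1, (h _ _).2 h0.symm, isPowTwo_one⟩ ?_
      rintro x ⟨y, hy, hpow⟩
      refine ⟨2 * y, (h _ _).2 ?_, hpow.two_mul S⟩
      rw [hs, (h _ _).1 hy]
    intro x
    obtain ⟨y, hy, hpow⟩ := key x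
    rwa [← (h _ _).1 hy]
  · have key : ∀ y x, x < y → ∃ a, pair x a ∈ G ∧ ∃ b, pair y b ∈ G ∧ 2 * a ≤ b := by
      refine sigma_one_induction (S := S) (fun x hx => absurd hx not_lt_zero) ?_
      intro y ih x hx
      refine ⟨e x, (h _ _).2 rfl, e (y + 1), (h _ _).2 rfl, ?_⟩
      rw [hs]
      refine mul_le_mul_of_nonneg_left ?_ zero_le_two
      rcases (lt_add_one_iff_le.1 hx).eq_or_lt with rfl | hlt
      · exact le_rfl
      · obtain ⟨a, ha, b, hb, hab⟩ := ih x hlt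
        rw [← (h _ _).1 ha, ← (h _ _).1 hb]
        exact (le_mul_of_one_le_left zero_le one_le_two).trans hab
    intro x y hxy
    obtain ⟨a, ha, b, hb, hab⟩ := key y x hxy
    rwa [← (h _ _).1 ha, ← (h _ _).1 hb]

/-- Let `E` be an approximation with a limit, and suppose that for every `s` there are a stage `t`
and a number `x`, both at least `s`, such that `x` lies in the sets with index below `s` as the
approximation at `t` says. Then the values `x` of the least such pairs form a cohesive set. Only
those `s` with `s ≤ x` matter for `x`, which makes the set `Δ⁰₁` without any recursion. -/
theorem cohesive_of_approximation [Fact (ModelsRCA0 S)] {U E : Set M} (hU : U ∈ S) (hE : E ∈ S)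
    (hlim : ∀ i, (∃ m, ∀ t, m ≤ t → pair t i ∈ E) ∨ ∃ m, ∀ t, m ≤ t → pair t i ∉ E)
    (hex : ∀ s, ∃ t x, s ≤ t ∧ s ≤ x ∧ ∀ i, i < s → (pair x i ∈ U ↔ pair t i ∈ E)) :
    ∃ C, C ∈ S ∧ Unbounded C ∧ IsCohesive (fun i => {x | pair x i ∈ U}) C := by
  have := SgSet.of_mem hU
  have := SgSet.of_mem hE
  obtain ⟨W, hW, hWiff⟩ := exists_pair_mem_iff (S := S) (θ := fun s u => ∃ t, t ≤ u ∧ ∃ x, x ≤ u ∧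
    u = pair t x ∧ s ≤ t ∧ s ≤ x ∧ ∀ i, i < s → (pair x i ∈ U ↔ pair t i ∈ E))
  have := SgSet.of_mem hW
  have hleast : ∀ s, ∃ u, pair s u ∈ W ∧ ∀ u', u' < u → pair s u' ∉ W := by
    intro s
    obtain ⟨t, x, ht, hx, h⟩ := hex s
    exact pi_one_least (S := S) (P := fun u => pair s u ∈ W) ⟨pair t x, (hWiff _ _).2
      ⟨t, left_le_pair t x, x, right_le_pair t x, rfl, ht, hx, h⟩⟩
  choose g hgW hgmin using hleast
  have hg : ∀ s u, u = g s ↔ pair s u ∈ W ∧ ∀ u', u' < u → pair s u' ∉ W := by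
    refine fun s u => ⟨by rintro rfl; exact ⟨hgW s, hgmin s⟩, fun ⟨h1, h2⟩ => ?_⟩
    exact (not_lt.1 fun h => h2 _ h (hgW s)).antisymm (not_lt.1 fun h => hgmin s _ h h1)
  obtain ⟨K, hK, hKiff⟩ := exists_pair_mem_iff (S := S)
    (θ := fun s u => pair s u ∈ W ∧ ∀ u', u' < u → pair s u' ∉ W)
  simp only [← hg] at hKiff
  have := SgSet.of_mem hK
  choose t ht x hx hgpair hst hsx hmatch using fun s => (hWiff s (g s)).1 (hgW s)
  have hC : {a | ∃ s, s ≤ a ∧ a = x s} ∈ S := by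
    have h1 : ∀ a, (∃ s, s ≤ a ∧ a = x s) ↔
        ∃ s, s ≤ a ∧ ∃ u, pair s u ∈ K ∧ ∃ b, b ≤ u ∧ u = pair b a := by
      refine fun a => exists_congr fun s => and_congr_right fun _ => ?_
      simp only [hKiff, exists_eq_left]
      constructor
      · rintro rfl
        exact ⟨t s, ht s, hgpair s⟩
      · rintro ⟨b, -, hb⟩
        exact (pair_inj (hb.symm.trans (hgpair s))).2
    have h2 : ∀ a, ¬ (∃ s, s ≤ a ∧ a = x s) ↔
        ∀ s, s ≤ a → ∃ u, pair s u ∈ K ∧ ¬ ∃ b, b ≤ u ∧ u = pair b a := by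
      intro a
      rw [h1]
      simp only [hKiff, exists_eq_left, not_exists, not_and]
    refine delta_one_mem ?_ ⟨?_⟩
    · simp only [h1]
      infer_instance
    · simp only [h2]
      infer_instance
  -- only boundedly many elements of `C` come from stages below a given one
  have hlate : ∀ s₀, ∃ b, ∀ s, b ≤ x s → s₀ ≤ s := by
    intro s₀
    obtain ⟨b, hb⟩ := bounding_one (S := S) (P := fun s u => pair s u ∈ K) (a := s₀)
      fun s _ => ⟨g s, (hKiff _ _).2 rfl⟩
    refine ⟨b, fun s hs => not_lt.1 fun hlt => ?_⟩
    obtain ⟨u, hu, hmem⟩ := hb s hlt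
    rw [(hKiff _ _).1 hmem] at hu
    exact absurd (hs.trans (hx s)) (not_le.2 hu)
  refine ⟨_, hC, fun ⟨b, hb⟩ => absurd (hb (x b) ⟨b, hsx b, rfl⟩) (not_lt.2 (hsx b)), fun i => ?_⟩
  refine (hlim i).imp ?_ ?_
  · rintro ⟨m, hm⟩
    obtain ⟨b, hb⟩ := hlate (max m (i + 1))
    refine ⟨b, ?_⟩
    rintro _ ⟨⟨s, -, rfl⟩, hn⟩
    refine not_le.1 fun hle => hn ?_
    have hs := hb s hle
    exact (hmatch s i ((lt_add_one i).trans_le ((le_max_right _ _).trans hs))).2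
      (hm _ ((le_max_left _ _).trans (hs.trans (hst s))))
  · rintro ⟨m, hm⟩
    obtain ⟨b, hb⟩ := hlate (max m (i + 1))
    refine ⟨b, ?_⟩
    rintro _ ⟨⟨s, -, rfl⟩, hn⟩
    refine not_le.1 fun hle => ?_
    have hs := hb s hle
    exact hm _ ((le_max_left _ _).trans (hs.trans (hst s)))
      ((hmatch s i ((lt_add_one i).trans_le ((le_max_right _ _).trans hs))).1 hn)

/-- The tree consists of the strings `σ` that describe the position of some number `x ≥ σ` with
respect to the first sets of the sequence. A path yields a limit behaviour for the sequence that
arbitrarily large numbers follow arbitrarily far, and this behaviour has a `Δ⁰₁` approximation. -/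
theorem DeltaTwoTreesHavePaths.coh [Fact (ModelsRCA0 S)] [Fact (BSigma S 2)]
    (h : DeltaTwoTreesHavePaths S) : COH S := by
  intro R hR
  obtain ⟨U, hU, hRU⟩ : ∃ U, U ∈ S ∧ ∀ i, R i = {x | pair x i ∈ U} := by
    refine ⟨_, hR, fun i => Set.ext fun x => ⟨fun hx => ⟨x, i, rfl, hx⟩, ?_⟩⟩
    rintro ⟨y, j, heq, hy⟩
    obtain ⟨rfl, rfl⟩ := pair_inj heq
    exact hy
  obtain rfl : R = fun i => {x | pair x i ∈ U} := funext hRU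
  clear hR hRU
  obtain ⟨e, G, hG, heG, hpow, hmono⟩ := exists_exp_isPowTwo S
  have := SgSet.of_mem hU
  have := SgSet.of_mem hG
  have hinj : ∀ {i j}, e i = e j → i = j := by
    have hlt : ∀ {i j}, i < j → e i < e j := fun {i j} hij =>
      (lt_mul_of_one_lt_left (hpow i).pos one_lt_two).trans_le (hmono i j hij)
    intro i j hij
    rcases lt_trichotomy i j with hlt' | heq | hlt'
    · exact absurd hij (hlt hlt').ne
    · exact heq
    · exact absurd hij (hlt hlt').ne'
  -- `pair x ρ ∈ V` if `x` lies in the set of the sequence whose index is the length of `ρ`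
  obtain ⟨V, hV, hVdef⟩ := exists_pair_mem_iff (S := S)
    (θ := fun x ρ => ∃ i, i ≤ x ∧ ∃ p, p ≤ ρ ∧ pair i p ∈ G ∧ ρ < 2 * p ∧ pair x i ∈ U)
  have := SgSet.of_mem hV
  -- the bound `i ≤ x` in the definition of `V` is harmless for the strings considered below
  have hVX : ∀ {x i ρ}, i ≤ x → InLevel (e i) ρ → (pair x ρ ∈ V ↔ pair x i ∈ U) := by
    intro x i ρ hi hρ
    rw [hVdef]
    constructor
    · rintro ⟨j, -, p, hp, hjp, hρp, hj⟩
      rw [heG] at hjp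
      subst hjp
      rwa [hinj (hρ.unique S ⟨hpow j, hp, hρp⟩)]
    · exact fun hmem => ⟨i, hi, e i, hρ.2.1, (heG _ _).2 rfl, hρ.2.2, hmem⟩
  have hTdef : Sg S 1 (fun v : Fin 1 → M => ∃ x, v 0 ≤ x ∧ Agree {ρ | pair x ρ ∈ V} (v 0)) := by
    simp only [Agree, ne_eq, Set.mem_ofPred_eq]
    infer_instance
  have hT : IsBinaryTree {σ | ∃ x, σ ≤ x ∧ Agree {ρ | pair x ρ ∈ V} σ} := by
    refine ⟨fun σ ⟨_, _, hσ⟩ => hσ.1, fun σ τ hpre ⟨x, hx, hτ⟩ => ?_⟩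
    exact ⟨x, hpre.le.trans hx, hτ.of_isPrefix S hpre⟩
  have hTu : Unbounded {σ | ∃ x, σ ≤ x ∧ Agree {ρ | pair x ρ ∈ V} σ} := by
    rintro ⟨b, hb⟩
    obtain ⟨p, hp, hbp⟩ := exists_isPowTwo_gt S b
    have h1 : Sg S 2 (fun v : Fin 1 → M => pair (2 * p) (v 0) ∈ V) := inferInstance
    have h2 : Pg S 2 (fun v : Fin 1 → M => pair (2 * p) (v 0) ∈ V) := inferInstance
    have : SgSet S 2 {ρ | pair (2 * p) ρ ∈ V} := ⟨h1.out⟩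
    have : PgSet S 2 {ρ | pair (2 * p) ρ ∈ V} := ⟨h2.out.out⟩
    obtain ⟨σ, hσ, hagree⟩ := exists_agree (X := {ρ | pair (2 * p) ρ ∈ V}) S hp
    exact absurd (hb σ ⟨2 * p, hσ.2.2.le, hagree⟩) (not_lt.2 (hbp.le.trans hσ.2.1))
  have hTΔ : IsDelta S 2 {σ | ∃ x, σ ≤ x ∧ Agree {ρ | pair x ρ ∈ V} σ} :=
    ⟨hTdef.succ.out, (Pg.of_sg hTdef).out.out⟩
  obtain ⟨P, hPΔ, hP, hPu, hPT⟩ := h _ hTΔ hT hTu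
  have := SgSet.mk hPΔ.1
  -- the indices of the levels at which the path turns right, and left
  have h₀ : Sg S 2 (fun v : Fin 1 → M => ∃ ρ p, pair (v 0) p ∈ G ∧ p ≤ ρ ∧ ρ < 2 * p ∧
    2 * ρ + 1 ∈ P) := inferInstance
  have h₁ : Sg S 2 (fun v : Fin 1 → M => ∃ ρ p, pair (v 0) p ∈ G ∧ p ≤ ρ ∧ ρ < 2 * p ∧
    2 * ρ ∈ P) := inferInstance
  have : SgSet S 2 {i | ∃ ρ p, pair i p ∈ G ∧ p ≤ ρ ∧ ρ < 2 * p ∧ 2 * ρ + 1 ∈ P} := ⟨h₀.out⟩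
  have : SgSet S 2 {i | ∃ ρ p, pair i p ∈ G ∧ p ≤ ρ ∧ ρ < 2 * p ∧ 2 * ρ ∈ P} := ⟨h₁.out⟩
  obtain ⟨E, hE, hE₀, hE₁⟩ := exists_approximation (S := S)
      (A₀ := {i | ∃ ρ p, pair i p ∈ G ∧ p ≤ ρ ∧ ρ < 2 * p ∧ 2 * ρ + 1 ∈ P})
      (A₁ := {i | ∃ ρ p, pair i p ∈ G ∧ p ≤ ρ ∧ ρ < 2 * p ∧ 2 * ρ ∈ P}) (by
    rw [Set.disjoint_left]
    rintro i ⟨ρ, p, hp, hpρ, hρp, hρ⟩ ⟨ρ', p', hp', hpρ', hρp', hρ'⟩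
    rw [heG] at hp hp'
    subst hp hp'
    have hl := InLevel.child S ⟨hpow i, hpρ, hρp⟩ one_lt_two
    have hl' := InLevel.child S ⟨hpow i, hpρ', hρp'⟩ zero_lt_two
    rw [add_zero] at hl'
    refine two_mul_ne_two_mul_add_one ρ' ρ ?_
    rcases hP.2 _ _ hρ hρ' with hpre | hpre
    · exact (hpre.eq_of_inLevel S hl hl').symm
    · exact hpre.eq_of_inLevel S hl' hl)
  have := SgSet.of_mem hE
  have hmatch : ∀ s, ∃ x, s ≤ x ∧ ∀ i, i < s →
      (pair x i ∈ U ∧ ∃ m, ∀ t, m ≤ t → pair t i ∈ E) ∨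
      (pair x i ∉ U ∧ ∃ m, ∀ t, m ≤ t → pair t i ∉ E) := by
    intro s
    obtain ⟨q, hq, hsq, heq⟩ : ∃ q, IsPowTwo q ∧ s ≤ q ∧ e s ≤ q := by
      obtain ⟨p, hp, hsp⟩ := exists_isPowTwo_gt S s
      rcases le_total p (e s) with hle | hle
      · exact ⟨e s, hpow s, hsp.le.trans hle, le_rfl⟩
      · exact ⟨p, hp, hsp.le, hle⟩
    obtain ⟨σ, hσ, hσP⟩ := exists_mem_inLevel S hP.1 hPu hq
    obtain ⟨x, hσx, hagree⟩ := hPT hσP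
    have hsx : s ≤ x := hsq.trans (hσ.2.1.trans hσx)
    refine ⟨x, hsx, fun i hi => ?_⟩
    obtain ⟨c, hc, hcσ⟩ := hσ.exists_prefix S ((hpow i).two_mul S) ((hmono i s hi).trans heq)
    obtain ⟨ρ, b, hρ, hb, rfl⟩ := InLevel.eq_child S (hpow i) hc
    have hcP := hP.1.2 _ _ hcσ hσP
    rw [← hVX (hi.le.trans hsx) hρ]
    rcases lt_two_iff.1 hb with rfl | rfl
    · rw [add_zero] at hcσ hcP
      exact .inr ⟨hagree.not_mem hρ.ne_zero hcσ,
        hE₁ i ⟨ρ, e i, (heG _ _).2 rfl, hρ.2.1, hρ.2.2, hcP⟩⟩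
    · exact .inl ⟨hagree.mem hρ.ne_zero hcσ,
        hE₀ i ⟨ρ, e i, (heG _ _).2 rfl, hρ.2.1, hρ.2.2, hcP⟩⟩
  have hlim : ∀ i, (∃ m, ∀ t, m ≤ t → pair t i ∈ E) ∨ ∃ m, ∀ t, m ≤ t → pair t i ∉ E := by
    intro i
    obtain ⟨x, -, hx⟩ := hmatch (i + 1)
    exact (hx i (lt_add_one i)).imp And.right And.right
  refine cohesive_of_approximation hU hE hlim fun s => ?_
  obtain ⟨x, hsx, hx⟩ := hmatch s
  obtain ⟨B, hB⟩ := bounding_two (S := S) (a := s) (P := fun i m =>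
    (∀ t, m ≤ t → pair t i ∈ E) ∨ ∀ t, m ≤ t → pair t i ∉ E)
    fun i _ => (hlim i).elim (fun ⟨m, hm⟩ => ⟨m, .inl hm⟩) (fun ⟨m, hm⟩ => ⟨m, .inr hm⟩)
  refine ⟨max s B, x, le_max_left _ _, hsx, fun i hi => ?_⟩
  obtain ⟨m, hmB, hm⟩ := hB i hi
  have hmt : m ≤ max s B := hmB.le.trans (le_max_right _ _)
  rcases hx i hi with ⟨hxi, m', hm'⟩ | ⟨hxi, m', hm'⟩
  · refine iff_of_true hxi ?_
    rcases hm with hm | hm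
    · exact hm _ hmt
    · exact absurd (hm' _ (le_max_right m m')) (hm _ (le_max_left m m'))
  · refine iff_of_false hxi ?_
    rcases hm with hm | hm
    · exact absurd (hm _ (le_max_left m m')) (hm' _ (le_max_right m m'))
    · exact hm _ hmt

end

end SecondOrderArith

theorem theorem3 {M : Type*} [SecondOrderArith.PMinus M] (S : Set (Set M))
    (hRCA : SecondOrderArith.ModelsRCA0 S) :
    (SecondOrderArith.BSigma S 2 →
      List.TFAE [SecondOrderArith.COH S, SecondOrderArith.SigmaTwoSeparation S,
        SecondOrderArith.DeltaTwoTreesHavePaths S]) ∧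
    (SecondOrderArith.COH S → SecondOrderArith.SigmaTwoSeparation S) := by
  have := Fact.mk hRCA
  refine ⟨fun hB => ?_, fun h => h.sigmaTwoSeparation⟩
  have := Fact.mk hB
  tfae_have 1 → 2 := fun h => h.sigmaTwoSeparation
  tfae_have 2 → 3 := fun h => h.deltaTwoTreesHavePaths
  tfae_have 3 → 1 := fun h => h.coh
  tfae_finish
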